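/- Let $\mathcal R=\{z\in\mathbb C:\operatorname{Re}z>0\}$, $\overline{\mathcal R}=\{\operatorname{Re}z\ge 0\}$ and, for $0<b<\infty$, $S_b=\{0<\operatorname{Re}z<b\}$. Let $H^2(S_b)$ be the space of holomorphic functions $f$ on $S_b$ with $\sup_{0<x<b}\int_{-\infty}^{\infty}|f(x+iy)|^2\,dy<\infty$. Let $\mathcal M^2_\omega$ be the space of holomorphic functions $f$ on $\mathcal R$ such that $f\in H^2(S_b)$ for every $0<b<\infty$ and, with boundary values $f(iy)=\lim_{x\to0^+}f(x+iy)$ (which exist for almost every $y$), $$\sum_{n=0}^{\infty}\frac{2^n}{n!}\int_{-\infty}^{\infty}\Big|f\Big(\frac n2+iy\Big)\Big|^2dy<\infty .$$ Let $\operatorname{Hol}(\overline{\mathcal R})$ be the space of functions holomorphic in a neighbourhood of $\overline{\mathcal R}$. Let $(z_j)_{j\ge1}$ be a sequence in $\mathcal R$ with $1\le|z_j|\to+\infty$; repetitions are allowed. Its exponent of convergence is $\rho_1=\inf\{\rho>0:\sum_j|z_j|^{-\rho}<\infty\}$, and its upper density is $d^+=\limsup_{r\to+\infty}n(r)/r^{\rho_1}$,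 where $n(r)=\#\{j:|z_j|\le r\}$. **Theorem.** (i) If $\rho_1=1$ and $d^+<\frac12$, then $(z_j)$ is a zero set for $\mathcal M^2_\omega\cap\operatorname{Hol}(\overline{\mathcal R})$: there is $f\in\mathcal M^2_\omega\cap\operatorname{Hol}(\overline{\mathcal R})$ whose zeros in $\overline{\mathcal R}$, counted with multiplicity, are exactly the $z_j$. (ii) If $(z_j)$ is a zero set for $\mathcal M^2_\omega\cap\operatorname{Hol}(\overline{\mathcal R})$, even only in the sense that some $f$ in this class has exactly the $z_j$, counted with multiplicity, as its zeros in $\mathcal R$ (zeros on the imaginary axis being allowed), then $$\limsup_{R\to+\infty}\frac1{\log R}\sum_{|z_j|\le R}\operatorname{Re}\Big(\frac1{z_j}\Big)\le\frac2\pi .$$ -/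

import Mathlib

open Filter MeasureTheory Set Topology

noncomputable section

namespace HalfPlane

/-- The open right half-plane `ℛ = {Re z > 0}`. -/
def rightHalfPlane : Set ℂ := {z | 0 < z.re}

/-- The closed right half-plane, the closure of `ℛ`. -/
def closedRightHalfPlane : Set ℂ := {z | 0 ≤ z.re}

/-- The vertical strip `S_b = {0 < Re z < b}`. -/
def strip (b : ℝ) : Set ℂ := {z | 0 < z.re ∧ z.re < b}

/-- The Hardy space `H²(S_b)`: functions holomorphic in the strip `S_b` with
`sup_{0 < x < b} ∫ |f (x + i y)|² dy < ∞`. -/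
def hardyStrip (b : ℝ) : Set (ℂ → ℂ) :=
  {f | DifferentiableOn ℂ f (strip b) ∧
    (⨆ x ∈ Ioo (0 : ℝ) b, ∫⁻ y : ℝ, ‖f ((x : ℂ) + (y : ℂ) * Complex.I)‖ₑ ^ 2) < ⊤}

/-- The Borel measure `ω = ∑ₙ (2ⁿ / n!) δ_{n/2}(x) ⊗ dy`, carried by the vertical lines
`Re z = n / 2`, `n = 0, 1, 2, …`. -/
def omegaMeasure : Measure ℂ :=
  Measure.sum fun n : ℕ =>
    ENNReal.ofReal (2 ^ n / (n.factorial : ℝ)) •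
      Measure.map (fun y : ℝ => (n : ℂ) / 2 + (y : ℂ) * Complex.I) volume

/-- A function on `ℛ` extended to the closed half-plane by its boundary values
`f (i y) = lim_{x → 0⁺} f (x + i y)`. For `f` in `H²(S_b)` the limit exists for almost every `y`.
Values off the closed half-plane are irrelevant and set to `0`. -/
def boundaryExtension (f : ℂ → ℂ) (z : ℂ) : ℂ :=
  if 0 < z.re then f z
  else if z.re = 0 then
    limUnder (𝓝[>] (0 : ℝ)) fun x : ℝ => f ((x : ℂ) + (z.im : ℂ) * Complex.I)
  else 0

/-- The space `ℳ²_ω(ℛ)`: functions holomorphic on `ℛ` that belong to `H²(S_b)` for every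
`0 < b < ∞` and, with their boundary values, to `L²(ω)`. Functions are represented by total
functions on `ℂ`; only the values on `ℛ` matter. -/
def M2omega : Set (ℂ → ℂ) :=
  {f | DifferentiableOn ℂ f rightHalfPlane ∧
    (∀ b : ℝ, 0 < b → f ∈ hardyStrip b) ∧
    MemLp (boundaryExtension f) 2 omegaMeasure}

/-- Functions holomorphic on the closed right half-plane, that is, on a neighbourhood of it. -/
def HolClosed : Set (ℂ → ℂ) := {f | AnalyticOnNhd ℂ f closedRightHalfPlane}

/-- The sequence `z` is a zero-set on `S` for the class `𝒦`: some function in `𝒦` has in `S` the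
zeros `z j`, counted with multiplicity, and no others. -/
def IsZeroSet (S : Set ℂ) (𝒦 : Set (ℂ → ℂ)) (z : ℕ → ℂ) : Prop :=
  ∃ f ∈ 𝒦, ∀ w ∈ S, analyticOrderAt f w = Set.encard {j : ℕ | z j = w}

/-- The exponent of convergence `inf {ρ > 0 : ∑ 1 / |z j| ^ ρ < ∞}` (`+∞` if there is no such
`ρ`). -/
def convergenceExponent (z : ℕ → ℂ) : EReal :=
  ⨅ (ρ : ℝ) (_ : 0 < ρ) (_ : Summable fun j : ℕ => 1 / ‖z j‖ ^ ρ), (ρ : EReal)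

/-- The counting function `n(r) = #{j : |z j| ≤ r}`, for sequences with `|z j| → ∞`. -/
def countingFunction (z : ℕ → ℂ) (r : ℝ) : ℕ := Set.ncard {j : ℕ | ‖z j‖ ≤ r}

/-- The upper density `limsup n(r) / r ^ ρ₁`, with `ρ₁` the (finite) exponent of convergence. -/
def upperDensity (z : ℕ → ℂ) : EReal :=
  limsup (fun r : ℝ =>
    (((countingFunction z r : ℝ) / r ^ (convergenceExponent z).toReal : ℝ) : EReal)) atTop

end HalfPlane

end

namespace HalfPlane

/-! Both directions compare a function with Blaschke-type factors of the half-plane. They rest on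
the identity `norm_add_conj_sq`: `v - a` and its reflection `v + conj a` have equal modulus on the
imaginary axis and differ in squared modulus by `4 Re v Re a`.

Necessity. A single term of the `ω`-norm bounds `f` in `L²` on the line `Re v = X`, `2X ∈ ℕ`, by a
constant times `X ^ X` (`lintegral_line_le`). Replace each zero of modulus at most `R` by its
reflection and multiply by `exp (-κ v)`, where `κ` is `log X` plus a small correction. The resulting
`g` is bounded in `L²` on both edges of the strip `0 < Re v < X`, independently of `X`.
Phragmén–Lindelöf then bounds `g` at a fixed point `p` (`norm_le_of_edges`). The reflection has made
`|g p|` larger than `|f p| exp (-κ p)` by a factor exponential in `S = ∑ Re (1 / z j)`, so `S` is at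
most a multiple of `log X` plus a constant (`sum_re_div_le`). With `X` comparable to `R` this is the
claim. As `p → 0` and `X / R → ∞` the coefficient of `log R` tends to `1/2`; the fixed choices made
below give `0.63 < 2 / π`.

Sufficiency. Blaschke factors with zeros `z j`, times exponentials that cancel the linear term of
their logarithms, have a convergent product because `∑ 1 / |z j| ^ 2 < ∞`. If `n(r) ≤ c r` for large
`r`, its modulus is at most `exp (2 c x log |v| + O(x))` for large `x = Re v` and at most `1` on the
imaginary axis (`norm_canonicalProduct_le_exp`). Multiplying by `exp (b (v + 1) log (v + 1))` adds
`b x log |v|` to the exponent and gives exponential decay in `|Im v|`. Since `n!` beats `exp (β n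
log n)` for `β < 1`, any `b > 0` with `2 c + b < 1` puts the product in the space
(`mem_M2omega_of_norm_le`), which is possible as `c < 1/2`. -/

/-! ### Boundary values and the lines that carry `ω`. -/

theorem isClosed_closedRightHalfPlane : IsClosed closedRightHalfPlane :=
  isClosed_le continuous_const Complex.continuous_re

theorem isOpen_rightHalfPlane : IsOpen rightHalfPlane :=
  isOpen_lt continuous_const Complex.continuous_re

theorem rightHalfPlane_subset : rightHalfPlane ⊆ closedRightHalfPlane :=
  fun _ h => le_of_lt (α := ℝ) h

theorem boundaryExtension_eq_of_mem {f : ℂ → ℂ} (hf : ContinuousOn f closedRightHalfPlane)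
    {z : ℂ} (hz : z ∈ closedRightHalfPlane) : boundaryExtension f z = f z := by
  unfold boundaryExtension
  split_ifs with h1 h2
  · rfl
  · refine Tendsto.limUnder_eq ?_
    have h3 := hf z hz
    have h4 : Tendsto (fun x : ℝ => (x : ℂ) + (z.im : ℂ) * Complex.I) (𝓝[>] (0 : ℝ))
        (𝓝[closedRightHalfPlane] z) := by
      refine tendsto_nhdsWithin_iff.2 ⟨?_, ?_⟩
      · have h5 : Continuous (fun x : ℝ => (x : ℂ) + (z.im : ℂ) * Complex.I) := by fun_prop
        have h6 := h5.tendsto 0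
        have h7 : ((0 : ℝ) : ℂ) + (z.im : ℂ) * Complex.I = z := by
          apply Complex.ext <;> simp [h2]
        rw [h7] at h6
        exact h6.mono_left nhdsWithin_le_nhds
      · filter_upwards [self_mem_nhdsWithin] with x hx
        have : (0 : ℝ) < x := hx
        simp [closedRightHalfPlane, this.le]
    exact h3.tendsto.comp h4
  · exact absurd (lt_of_le_of_ne hz (Ne.symm h2)) h1

theorem measurable_boundaryExtension {f : ℂ → ℂ} (hf : ContinuousOn f closedRightHalfPlane) :
    Measurable (boundaryExtension f) := by
  classical
  have h : boundaryExtension f = closedRightHalfPlane.piecewise f 0 := by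
    funext z
    by_cases hz : z ∈ closedRightHalfPlane
    · rw [piecewise_eq_of_mem _ _ _ hz, boundaryExtension_eq_of_mem hf hz]
    · rw [piecewise_eq_of_notMem _ _ _ hz]
      have hz' : z.re < 0 := not_le.1 hz
      simp [boundaryExtension, hz'.not_gt, hz'.ne]
  rw [h]
  exact hf.measurable_piecewise continuousOn_const isClosed_closedRightHalfPlane.measurableSet

theorem lintegral_omegaMeasure {h : ℂ → ENNReal} (hh : Measurable h) :
    ∫⁻ z, h z ∂omegaMeasure = ∑' n : ℕ, ENNReal.ofReal (2 ^ n / (n.factorial : ℝ)) *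
      ∫⁻ y : ℝ, h ((n : ℂ) / 2 + (y : ℂ) * Complex.I) := by
  rw [omegaMeasure, lintegral_sum_measure]
  congr 1
  funext n
  rw [lintegral_smul_measure, lintegral_map hh (by fun_prop), smul_eq_mul]

/-- One term of a convergent series is at most its sum, and `n! ≤ n ^ n`. With `X = n / 2` the bound
reads `M (X ^ X) ^ 2`. -/
theorem lintegral_line_le {f : ℂ → ℂ} (hf : ContinuousOn f closedRightHalfPlane)
    (hm : MemLp (boundaryExtension f) 2 omegaMeasure) :
    ∃ M : ℝ, 0 ≤ M ∧ ∀ n : ℕ, ∫⁻ y : ℝ, ‖f ((n : ℂ) / 2 + (y : ℂ) * Complex.I)‖ₑ ^ 2 ≤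
      ENNReal.ofReal (M * ((n : ℝ) / 2) ^ n) := by
  have h1 : ∫⁻ z, ‖boundaryExtension f z‖ₑ ^ 2 ∂omegaMeasure ≠ ⊤ := by
    have := hm.eLpNorm_lt_top
    rw [eLpNorm_lt_top_iff_lintegral_rpow_enorm_lt_top (by simp) (by simp)] at this
    simpa using this.ne
  refine ⟨(∫⁻ z, ‖boundaryExtension f z‖ₑ ^ 2 ∂omegaMeasure).toReal, ENNReal.toReal_nonneg, ?_⟩
  intro n
  have h2 : ENNReal.ofReal (2 ^ n / (n.factorial : ℝ)) *
      ∫⁻ y : ℝ, ‖f ((n : ℂ) / 2 + (y : ℂ) * Complex.I)‖ₑ ^ 2 ≤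
      ∫⁻ z, ‖boundaryExtension f z‖ₑ ^ 2 ∂omegaMeasure := by
    rw [lintegral_omegaMeasure ((measurable_boundaryExtension hf).enorm.pow_const 2)]
    refine le_trans (le_of_eq ?_) (ENNReal.le_tsum n)
    congr 1
    refine lintegral_congr fun y => ?_
    rw [boundaryExtension_eq_of_mem hf]
    simp only [closedRightHalfPlane, mem_ofPred_eq]
    have : ((n : ℂ) / 2 + (y : ℂ) * Complex.I).re = (n : ℝ) / 2 := by simp
    rw [this]; positivity
  have hc : (0 : ℝ) < 2 ^ n / (n.factorial : ℝ) := by positivity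
  have h3 := (ENNReal.mul_le_iff_le_inv (by simpa using hc) ENNReal.ofReal_ne_top).1 h2
  refine h3.trans ?_
  rw [← ENNReal.ofReal_inv_of_pos hc]
  nth_rewrite 1 [← ENNReal.ofReal_toReal h1]
  rw [← ENNReal.ofReal_mul (by positivity), mul_comm]
  refine ENNReal.ofReal_le_ofReal (mul_le_mul_of_nonneg_left ?_ ENNReal.toReal_nonneg)
  rw [inv_div, div_pow]
  gcongr
  exact_mod_cast n.factorial_le_pow

/-! ### Pointwise bounds in a strip from `L²` bounds on its edges. -/

theorem enorm_integral_le_one_add {h : ℝ → ℂ} {s M : ℝ} (hs0 : 0 ≤ s) (hs1 : s ≤ 1) (hM : 0 ≤ M)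
    (hb : ∫⁻ t in Icc (0 : ℝ) 1, ‖h t‖ₑ ^ 2 ≤ ENNReal.ofReal M) :
    ‖∫ t in (0 : ℝ)..s, h t‖ ≤ 1 + M := by
  rw [intervalIntegral.integral_of_le hs0]
  have h1 : ‖∫ t in Ioc 0 s, h t‖ₑ ≤ ENNReal.ofReal (1 + M) := by
    refine (enorm_integral_le_lintegral_enorm _).trans ?_
    calc ∫⁻ t in Ioc 0 s, ‖h t‖ₑ ≤ ∫⁻ t in Icc 0 1, ‖h t‖ₑ :=
          lintegral_mono_set (fun t ht => ⟨ht.1.le, ht.2.trans hs1⟩)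
      _ ≤ ∫⁻ t in Icc (0 : ℝ) 1, (1 + ‖h t‖ₑ ^ 2) := by
          refine lintegral_mono fun t => ?_
          rcases le_total ‖h t‖ₑ 1 with h1 | h1
          · exact h1.trans le_self_add
          · calc ‖h t‖ₑ = ‖h t‖ₑ * 1 := (mul_one _).symm
              _ ≤ ‖h t‖ₑ * ‖h t‖ₑ := by gcongr
              _ = ‖h t‖ₑ ^ 2 := (sq _).symm
              _ ≤ _ := le_add_self
      _ = 1 + ∫⁻ t in Icc (0 : ℝ) 1, ‖h t‖ₑ ^ 2 := by
          rw [lintegral_add_left measurable_const]; simp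
      _ ≤ 1 + ENNReal.ofReal M := by gcongr
      _ = ENNReal.ofReal (1 + M) := by rw [ENNReal.ofReal_add zero_le_one hM]; simp
  rwa [← ofReal_norm, ENNReal.ofReal_le_ofReal_iff (by positivity)] at h1

theorem lintegral_segment_le {g : ℂ → ℂ} (x y : ℝ) :
    ∫⁻ t in Icc (0 : ℝ) 1, ‖g ((x : ℂ) + (y : ℂ) * Complex.I + (t : ℂ) * Complex.I)‖ₑ ^ 2 ≤
      ∫⁻ t : ℝ, ‖g ((x : ℂ) + (t : ℂ) * Complex.I)‖ₑ ^ 2 := by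
  rw [← lintegral_add_left_eq_self
    (fun t : ℝ => ‖g ((x : ℂ) + (t : ℂ) * Complex.I)‖ₑ ^ 2) y]
  refine (setLIntegral_le_lintegral _ _).trans (le_of_eq (lintegral_congr fun t => ?_))
  congr 3
  push_cast; ring

/-- The integral of `g` over the vertical segment of length `s` going up from `w`. -/
noncomputable def segmentIntegral (g : ℂ → ℂ) (s : ℝ) (w : ℂ) : ℂ :=
  ∫ t in (0 : ℝ)..s, g (w + (t : ℂ) * Complex.I)

theorem hasDerivAt_segmentIntegral {g : ℂ → ℂ} (hg : AnalyticOnNhd ℂ g rightHalfPlane)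
    (hc : Continuous g) (s : ℝ) {w : ℂ} (hw : w ∈ rightHalfPlane) :
    HasDerivAt (segmentIntegral g s) ((g (w + (s : ℂ) * Complex.I) - g w) / Complex.I) w := by
  have hw' : 0 < w.re := hw
  have hmem : ∀ v ∈ Metric.closedBall w (w.re / 2), ∀ t : ℝ,
      v + (t : ℂ) * Complex.I ∈ rightHalfPlane := by
    intro v hv t
    have h1 : |(v - w).re| ≤ w.re / 2 :=
      (Complex.abs_re_le_norm _).trans (by simpa [dist_eq_norm] using hv)
    have h2 := (abs_le.1 h1).1
    simp only [Complex.sub_re] at h2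
    simp only [rightHalfPlane, mem_ofPred_eq, Complex.add_re, Complex.mul_re, Complex.ofReal_re,
      Complex.I_re, Complex.ofReal_im, Complex.I_im]
    linarith
  have hd : ContinuousOn (deriv g) rightHalfPlane := hg.deriv.continuousOn
  have hd' : Continuous (fun t : ℝ => deriv g (w + (t : ℂ) * Complex.I)) := by
    refine hd.comp_continuous (by fun_prop) fun t => hmem w ?_ t
    exact Metric.mem_closedBall_self (by linarith)
  obtain ⟨B, hB⟩ : ∃ B, ∀ p ∈ Metric.closedBall w (w.re / 2) ×ˢ uIcc 0 s,
      ‖deriv g (p.1 + (p.2 : ℂ) * Complex.I)‖ ≤ B := by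
    refine IsCompact.exists_bound_of_continuousOn
      ((isCompact_closedBall _ _).prod isCompact_uIcc) ?_
    refine hd.comp (by fun_prop) fun p hp => hmem _ hp.1 _
  have key := (intervalIntegral.hasDerivAt_integral_of_dominated_loc_of_deriv_le (μ := volume)
    (F := fun (v : ℂ) (t : ℝ) => g (v + (t : ℂ) * Complex.I))
    (F' := fun (v : ℂ) (t : ℝ) => deriv g (v + (t : ℂ) * Complex.I)) (a := 0) (b := s)
    (bound := fun _ => B)
    (Metric.closedBall_mem_nhds w (half_pos hw'))
    (Eventually.of_forall fun v => (by fun_prop : Continuous _).aestronglyMeasurable)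
    ((by fun_prop : Continuous _).intervalIntegrable _ _)
    hd'.aestronglyMeasurable
    (Eventually.of_forall fun t ht v hv => hB (v, t) ⟨hv, uIoc_subset_uIcc ht⟩)
    intervalIntegrable_const
    (Eventually.of_forall fun t ht v hv => by
      have h1 := (hg _ (hmem v hv t)).differentiableAt.hasDerivAt
      exact h1.comp_add_const v ((t : ℂ) * Complex.I))).2
  have hftc : ∫ t in (0 : ℝ)..s, deriv g (w + (t : ℂ) * Complex.I) =
      (g (w + (s : ℂ) * Complex.I) - g w) / Complex.I := by
    rw [intervalIntegral.integral_eq_sub_of_hasDerivAt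
      (f := fun t : ℝ => g (w + (t : ℂ) * Complex.I) / Complex.I) _
      (hd'.intervalIntegrable _ _)]
    · simp [sub_div]
    · intro t _
      have h1 := (hg _ (hmem w (Metric.mem_closedBall_self (by linarith)) t)).differentiableAt.hasDerivAt
      have h2 : HasDerivAt (fun t : ℝ => w + (t : ℂ) * Complex.I) (1 * Complex.I) t :=
        ((Complex.ofRealCLM.hasDerivAt (x := t)).mul_const Complex.I).const_add w
      have h3 := (h1.comp t h2).div_const Complex.I
      rwa [one_mul, mul_div_cancel_right₀ _ Complex.I_ne_zero] at h3
  rw [hftc] at key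
  exact key

theorem continuous_segmentIntegral {g : ℂ → ℂ} (hc : Continuous g) (s : ℝ) :
    Continuous (segmentIntegral g s) := by
  unfold segmentIntegral
  exact intervalIntegral.continuous_parametric_intervalIntegral_of_continuous'
    (f := fun (w : ℂ) (t : ℝ) => g (w + (t : ℂ) * Complex.I)) (by fun_prop) 0 s

/-- A pointwise bound inside a strip in terms of `L²` norms on the two edges. -/
theorem norm_le_of_edges {g : ℂ → ℂ} {X M B T p r : ℝ} (hX : 0 < X) (hM : 0 ≤ M) (hB : 0 ≤ B)
    (hg : AnalyticOnNhd ℂ g rightHalfPlane) (hc : Continuous g)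
    (h0 : ∀ y : ℝ, ∫⁻ t in Icc (0 : ℝ) 1,
      ‖g (((0 : ℝ) : ℂ) + (y : ℂ) * Complex.I + (t : ℂ) * Complex.I)‖ₑ ^ 2 ≤ ENNReal.ofReal M)
    (h1 : ∀ y : ℝ, ∫⁻ t in Icc (0 : ℝ) 1,
      ‖g ((X : ℂ) + (y : ℂ) * Complex.I + (t : ℂ) * Complex.I)‖ₑ ^ 2 ≤ ENNReal.ofReal M)
    (hgrow : ∀ x ∈ Ioo 0 X, ∀ y : ℝ, T ≤ |y| → ∫⁻ t in Icc (0 : ℝ) 1,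
      ‖g ((x : ℂ) + (y : ℂ) * Complex.I + (t : ℂ) * Complex.I)‖ₑ ^ 2 ≤ ENNReal.ofReal B)
    (hr : 0 < r) (hpr : r < p) (hpX : p + r < X) :
    ‖g p‖ ≤ (1 / r + 1) * (1 + M) := by
  -- Segment integrals, unlike `g` itself, are bounded pointwise on the edges by the `L²` data, so
  -- Phragmén–Lindelöf applies to them.
  have hA : ∀ s ∈ Icc (0 : ℝ) 1, ∀ w : ℂ, 0 ≤ w.re → w.re ≤ X →
      ‖segmentIntegral g s w‖ ≤ 1 + M := by
    intro s hs w hw0 hwX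
    refine PhragmenLindelof.vertical_strip (a := 0) (b := X) ?_ ?_ ?_ ?_ hw0 hwX
    · refine ⟨fun v hv => ?_, (continuous_segmentIntegral hc s).continuousOn⟩
      exact (hasDerivAt_segmentIntegral hg hc s hv.1).differentiableAt.differentiableWithinAt
    -- Zero exponents mean that plain boundedness far up and down the strip is shown, far more than
    -- the double exponential growth allowed.
    · refine ⟨0, by simp only [sub_zero]; positivity, 0, ?_⟩
      refine Asymptotics.IsBigO.of_bound (1 + B) ?_
      have h2 : ∀ᶠ v in comap (_root_.abs ∘ Complex.im) atTop, T ≤ |v.im| :=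
        tendsto_comap.eventually (eventually_ge_atTop T)
      filter_upwards [h2.filter_mono inf_le_left, mem_inf_of_right (mem_principal_self _)]
        with v hv1 hv2
      have := enorm_integral_le_one_add hs.1 hs.2 hB (by
        simpa [Complex.re_add_im] using hgrow v.re hv2 v.im hv1)
      simpa [segmentIntegral] using this
    · intro v hv
      refine enorm_integral_le_one_add hs.1 hs.2 hM ?_
      have h2 : (((0 : ℝ) : ℂ) + (v.im : ℂ) * Complex.I) = v := by rw [← hv, Complex.re_add_im]
      simpa only [h2] using h0 v.im
    · intro v hv
      refine enorm_integral_le_one_add hs.1 hs.2 hM ?_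
      have := h1 v.im
      rwa [← hv, Complex.re_add_im] at this
  have hre : ∀ v ∈ Metric.closedBall (p : ℂ) r, 0 < v.re ∧ v.re < X := by
    intro v hv
    have h1 : |(v - p).re| ≤ r :=
      (Complex.abs_re_le_norm _).trans (by simpa [dist_eq_norm] using hv)
    have h2 := abs_le.1 h1
    simp only [Complex.sub_re, Complex.ofReal_re] at h2
    exact ⟨by linarith, by linarith⟩
  have hpmem : (p : ℂ) ∈ rightHalfPlane := by
    simp only [rightHalfPlane, mem_ofPred_eq, Complex.ofReal_re]; linarith
  have hdiff : ∀ s ∈ Icc (0 : ℝ) 1, ‖g p - g (p + (s : ℂ) * Complex.I)‖ ≤ (1 + M) / r := by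
    intro s hs
    have h2 := Complex.norm_deriv_le_of_forall_mem_sphere_norm_le (f := segmentIntegral g s)
      (c := (p : ℂ)) (R := r) (C := 1 + M) hr ?_ ?_
    · rw [(hasDerivAt_segmentIntegral hg hc s hpmem).deriv] at h2
      rw [norm_sub_rev]
      simpa using h2
    · refine DifferentiableOn.diffContOnCl fun v hv => ?_
      have h3 := hre v (Metric.closure_ball_subset_closedBall hv)
      exact (hasDerivAt_segmentIntegral hg hc s h3.1).differentiableAt.differentiableWithinAt
    · intro v hv
      have h3 := hre v (Metric.sphere_subset_closedBall hv)
      exact hA s hs v h3.1.le h3.2.le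
  -- `g p` is its mean over a unit vertical segment plus the mean deviation from it. The deviations
  -- are derivatives of segment integrals, which Cauchy's estimate on radius `r` controls.
  have hdec : g p = (∫ s in (0 : ℝ)..1, (g p - g (p + (s : ℂ) * Complex.I))) +
      segmentIntegral g 1 p := by
    rw [segmentIntegral, ← intervalIntegral.integral_add]
    · simp
    · exact (by fun_prop : Continuous _).intervalIntegrable _ _
    · exact (by fun_prop : Continuous _).intervalIntegrable _ _
  rw [hdec]
  refine (norm_add_le _ _).trans ?_
  have h2 : ‖∫ s in (0 : ℝ)..1, (g p - g (p + (s : ℂ) * Complex.I))‖ ≤ (1 + M) / r * |1 - 0| := by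
    refine intervalIntegral.norm_integral_le_of_norm_le_const fun s hs => hdiff s ?_
    rw [uIoc_of_le zero_le_one] at hs
    exact ⟨hs.1.le, hs.2⟩
  have h3 := hA 1 ⟨zero_le_one, le_rfl⟩ p hpmem.le (by simp; linarith)
  simp only [sub_zero, abs_one, mul_one] at h2
  calc _ ≤ (1 + M) / r + (1 + M) := add_le_add h2 h3
    _ = _ := by ring

/-! ### Dividing out zeros and reflecting them. -/

theorem analyticAt_dslope {f : ℂ → ℂ} {a v : ℂ} (ha : AnalyticAt ℂ f a) (hv : AnalyticAt ℂ f v) :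
    AnalyticAt ℂ (dslope f a) v := by
  by_cases h : v = a
  · subst h
    obtain ⟨p, hp⟩ := ha
    exact ⟨_, hp.has_fpower_series_dslope_fslope⟩
  · have h1 : AnalyticAt ℂ (fun w => (f w - f a) / (w - a)) v :=
      (hv.sub analyticAt_const).div (analyticAt_id.sub analyticAt_const) (sub_ne_zero.2 h)
    refine h1.congr ?_
    filter_upwards [isOpen_ne.mem_nhds h] with w hw
    rw [dslope_of_ne _ hw, slope_def_field]

/-- Each zero is removed by `dslope`, which lowers the order by one there and leaves it unchanged
elsewhere. The factorisation of a total function by `dslope` holds at every point of `ℂ`. -/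
theorem exists_eq_mul_prod_sub {z : ℕ → ℂ} (s : Finset ℕ) (hz : ∀ j ∈ s, z j ∈ rightHalfPlane)
    {f : ℂ → ℂ} (hf : AnalyticOnNhd ℂ f closedRightHalfPlane)
    (hord : ∀ w ∈ rightHalfPlane, ((s.filter (z · = w)).card : ℕ∞) ≤ analyticOrderAt f w) :
    ∃ q : ℂ → ℂ, AnalyticOnNhd ℂ q closedRightHalfPlane ∧
      ∀ v, f v = q v * ∏ j ∈ s, (v - z j) := by
  induction s using Finset.induction_on generalizing f with
  | empty => exact ⟨f, hf, by simp⟩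
  | insert a s ha ih =>
    have haz : z a ∈ rightHalfPlane := hz a (Finset.mem_insert_self _ _)
    have hfa := hf _ (rightHalfPlane_subset haz)
    have hd : AnalyticOnNhd ℂ (dslope f (z a)) closedRightHalfPlane :=
      fun v hv => analyticAt_dslope hfa (hf v hv)
    have h0 : f (z a) = 0 := by
      apply apply_eq_zero_of_analyticOrderAt_ne_zero
      intro h
      have := hord _ haz
      rw [h] at this
      simp [Finset.filter_insert, ha] at this
    have hfac : f = fun v => (v - z a) * dslope f (z a) v := by
      funext v
      have := sub_smul_dslope f (z a) v
      rw [h0, sub_zero, smul_eq_mul] at this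
      exact this.symm
    obtain ⟨q, hq, hqf⟩ := ih (fun j hj => hz j (Finset.mem_insert_of_mem hj)) hd (by
      intro w hw
      have h1 := hord w hw
      have hl : AnalyticAt ℂ (fun v => v - z a) w := by fun_prop
      rw [hfac, show (fun v => (v - z a) * dslope f (z a) v) =
        (fun v => v - z a) * dslope f (z a) from rfl,
        analyticOrderAt_mul hl (hd w (rightHalfPlane_subset hw))] at h1
      by_cases hw' : z a = w
      · subst hw'
        rw [Finset.filter_insert, if_pos rfl, Finset.card_insert_of_notMem (by simp [ha]),
          show analyticOrderAt (fun v => v - z a) (z a) = 1 from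
            analyticOrderAt_id_sub_const_self, add_comm] at h1
        push_cast at h1
        exact (ENat.add_le_add_iff_left (by decide : (1 : ℕ∞) ≠ ⊤)).1 h1
      · rw [Finset.filter_insert, if_neg hw',
          show analyticOrderAt (fun v => v - z a) w = 0 from
            analyticOrderAt_id_sub_const_of_ne (Ne.symm hw'), zero_add] at h1
        exact h1)
    refine ⟨q, hq, fun v => ?_⟩
    rw [hfac, Finset.prod_insert ha]
    simp only
    rw [hqf v]
    ring

theorem norm_add_conj_sq (v a : ℂ) :
    ‖v + (starRingEnd ℂ) a‖ ^ 2 = ‖v - a‖ ^ 2 + 4 * v.re * a.re := by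
  simp only [Complex.sq_norm, Complex.normSq_apply, Complex.add_re, Complex.add_im,
    Complex.sub_re, Complex.sub_im, Complex.conj_re, Complex.conj_im]
  ring

theorem norm_add_conj_le_exp {v a : ℂ} {D : ℝ} (hv : 0 ≤ v.re) (ha : 0 ≤ a.re) (hD : 0 < D)
    (h : D ≤ ‖v - a‖) :
    ‖v + (starRingEnd ℂ) a‖ ≤ ‖v - a‖ * Real.exp (2 * v.re * a.re / D ^ 2) := by
  refine le_of_sq_le_sq ?_ (by positivity)
  rw [norm_add_conj_sq, mul_pow, ← Real.exp_nat_mul]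
  have h1 : D ^ 2 ≤ ‖v - a‖ ^ 2 := by gcongr
  have h2 := Real.add_one_le_exp ((2 : ℕ) * (2 * v.re * a.re / D ^ 2))
  have h3 : 4 * v.re * a.re ≤ ‖v - a‖ ^ 2 * (4 * v.re * a.re / D ^ 2) := by
    calc 4 * v.re * a.re = D ^ 2 * (4 * v.re * a.re / D ^ 2) := by field_simp
      _ ≤ _ := by gcongr
  calc ‖v - a‖ ^ 2 + 4 * v.re * a.re
      ≤ ‖v - a‖ ^ 2 * ((2 : ℕ) * (2 * v.re * a.re / D ^ 2) + 1) := by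
        push_cast
        have : (2 : ℝ) * (2 * v.re * a.re / D ^ 2) = 4 * v.re * a.re / D ^ 2 := by ring
        rw [this]; linarith
    _ ≤ _ := by gcongr

/-- The gain at `p` from reflecting a zero. The squared moduli differ by `4 p Re a`, and `|p + conj
a| ≤ (1 + p) |a|` because `|a| ≥ 1`, so the relative gain is of order `Re (1 / a)`. -/
theorem norm_sub_mul_exp_le {p : ℝ} {a : ℂ} (hp : 0 < p) (ha : 0 < a.re) (h1 : 1 ≤ ‖a‖) :
    ‖(p : ℂ) - a‖ * Real.exp (2 * p * (a.re / ‖a‖ ^ 2) / (1 + p) ^ 2) ≤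
      ‖(p : ℂ) + (starRingEnd ℂ) a‖ := by
  refine le_of_sq_le_sq ?_ (norm_nonneg _)
  have e1 := norm_add_conj_sq (p : ℂ) a
  rw [Complex.ofReal_re] at e1
  set N := ‖(p : ℂ) + (starRingEnd ℂ) a‖ with hN
  set u := 2 * p * (a.re / ‖a‖ ^ 2) / (1 + p) ^ 2 with hu
  have hNle : N ≤ (1 + p) * ‖a‖ := by
    calc N ≤ ‖(p : ℂ)‖ + ‖(starRingEnd ℂ) a‖ := norm_add_le _ _
      _ = p + ‖a‖ := by rw [RCLike.norm_conj, Complex.norm_real, Real.norm_of_nonneg hp.le]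
      _ ≤ _ := by nlinarith
  have h2 : N ^ 2 * (2 * u) ≤ 4 * p * a.re := by
    calc N ^ 2 * (2 * u) ≤ ((1 + p) * ‖a‖) ^ 2 * (2 * u) := by gcongr
      _ = 4 * p * a.re := by rw [hu]; field_simp; ring
  have h3 : ‖(p : ℂ) - a‖ ^ 2 ≤ N ^ 2 * (1 - 2 * u) := by nlinarith
  have h4 : 1 - 2 * u ≤ Real.exp (-(2 * u)) := by
    have := Real.add_one_le_exp (-(2 * u)); linarith
  rw [mul_pow, ← Real.exp_nat_mul]
  calc ‖(p : ℂ) - a‖ ^ 2 * Real.exp ((2 : ℕ) * u)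
      ≤ (N ^ 2 * Real.exp (-(2 * u))) * Real.exp ((2 : ℕ) * u) := by
        gcongr
        exact h3.trans (by gcongr)
    _ = N ^ 2 := by
        rw [mul_assoc, ← Real.exp_add]; simp

/-- The horizontal retraction of the plane onto the closed right half-plane. -/
noncomputable def retract (z : ℂ) : ℂ := ((max z.re 0 : ℝ) : ℂ) + (z.im : ℂ) * Complex.I

theorem continuous_retract : Continuous retract := by
  unfold retract
  fun_prop

theorem retract_mem (z : ℂ) : retract z ∈ closedRightHalfPlane := by
  simp [retract, closedRightHalfPlane]

theorem retract_of_mem {z : ℂ} (hz : z ∈ closedRightHalfPlane) : retract z = z := by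
  have hz' : 0 ≤ z.re := hz
  rw [retract, max_eq_left hz', Complex.re_add_im]

/-- An upper bound for the zeros of `f`, obtained by dividing them out in a strip. -/
theorem sum_re_div_le {f : ℂ → ℂ} (hf : AnalyticOnNhd ℂ f closedRightHalfPlane) {z : ℕ → ℂ}
    {s : Finset ℕ} {R X M B p r : ℝ} (hz : ∀ j ∈ s, z j ∈ rightHalfPlane)
    (hz1 : ∀ j ∈ s, 1 ≤ ‖z j‖) (hzR : ∀ j ∈ s, ‖z j‖ ≤ R)
    (hord : ∀ w ∈ rightHalfPlane, ((s.filter (z · = w)).card : ℕ∞) ≤ analyticOrderAt f w)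
    (hR : 0 ≤ R) (hRX : R < X) (hX : 1 ≤ X) (hM : 0 ≤ M) (hB : 0 ≤ B)
    (h0 : ∫⁻ y : ℝ, ‖f (((0 : ℝ) : ℂ) + (y : ℂ) * Complex.I)‖ₑ ^ 2 ≤ ENNReal.ofReal M)
    (h1 : ∫⁻ y : ℝ, ‖f ((X : ℂ) + (y : ℂ) * Complex.I)‖ₑ ^ 2 ≤
      ENNReal.ofReal (M * (X ^ X) ^ 2))
    (hstrip : ∀ x ∈ Ioo 0 X, ∫⁻ y : ℝ, ‖f ((x : ℂ) + (y : ℂ) * Complex.I)‖ₑ ^ 2 ≤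
      ENNReal.ofReal B)
    (hr : 0 < r) (hpr : r < p) (hpX : p + r < X) (hfp : f p ≠ 0) :
    2 * p * (∑ j ∈ s, (z j).re / ‖z j‖ ^ 2) / (1 + p) ^ 2 ≤
      Real.log ((1 / r + 1) * (1 + M)) - Real.log ‖f p‖ +
        p * (Real.log X + 2 * (∑ j ∈ s, (z j).re) / (X - R) ^ 2) := by
  obtain ⟨q, hq, hqf⟩ := exists_eq_mul_prod_sub s hz hf hord
  set D := X - R with hD
  have hDpos : 0 < D := sub_pos.2 hRX
  have hre : ∀ j ∈ s, 0 < (z j).re := hz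
  set c := 2 * (∑ j ∈ s, (z j).re) / D ^ 2 with hc
  have hc0 : 0 ≤ c := by
    have : 0 ≤ ∑ j ∈ s, (z j).re := Finset.sum_nonneg fun j hj => (hre j hj).le
    positivity
  have hlX : 0 ≤ Real.log X := Real.log_nonneg hX
  set κ := Real.log X + c with hκ
  have hκ0 : 0 ≤ κ := by positivity
  -- The exponential is calibrated for the right edge: `exp (κ X)` is `X ^ X`, the growth of `f`
  -- there, times `exp (c X)`, a bound for the cost of reflecting the zeros.
  set g₀ : ℂ → ℂ := fun v => q v * (∏ j ∈ s, (v + (starRingEnd ℂ) (z j))) *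
    Complex.exp (-(κ : ℂ) * v) with hg₀
  have hg₀a : AnalyticOnNhd ℂ g₀ closedRightHalfPlane := by
    intro v hv
    refine ((hq v hv).mul ?_).mul ?_
    · exact Finset.analyticAt_fun_prod _ fun j _ => by fun_prop
    · fun_prop
  have hng₀ : ∀ v, ‖g₀ v‖ = ‖q v‖ * (∏ j ∈ s, ‖v + (starRingEnd ℂ) (z j)‖) *
      Real.exp (-κ * v.re) := by
    intro v
    simp only [hg₀, norm_mul, norm_prod, Complex.norm_exp]
    simp
  have hnf : ∀ v, ‖f v‖ = ‖q v‖ * ∏ j ∈ s, ‖v - z j‖ := by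
    intro v
    rw [hqf v, norm_mul, norm_prod]
  -- Composing with the retraction makes the function continuous on all of `ℂ`, as
  -- `norm_le_of_edges` requires, without changing it on the closed half-plane.
  set g : ℂ → ℂ := fun v => g₀ (retract v) with hg
  have hgg₀ : ∀ v ∈ closedRightHalfPlane, g v = g₀ v := fun v hv => by
    simp only [hg]; rw [retract_of_mem hv]
  have hgc : Continuous g := hg₀a.continuousOn.comp_continuous continuous_retract retract_mem
  have hga : AnalyticOnNhd ℂ g rightHalfPlane := by
    intro v hv
    refine (hg₀a v (rightHalfPlane_subset hv)).congr ?_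
    filter_upwards [isOpen_rightHalfPlane.mem_nhds hv] with w hw
    exact (hgg₀ w (rightHalfPlane_subset hw)).symm
  have hmem : ∀ x y : ℝ, 0 ≤ x → (x : ℂ) + (y : ℂ) * Complex.I ∈ closedRightHalfPlane := by
    intro x y hx
    simpa [closedRightHalfPlane] using hx
  have hre' : ∀ x y : ℝ, ((x : ℂ) + (y : ℂ) * Complex.I).re = x := by
    intro x y; simp
  have him' : ∀ x y : ℝ, ((x : ℂ) + (y : ℂ) * Complex.I).im = y := by
    intro x y; simp
  have key := norm_le_of_edges (g := g) (X := X) (M := M) (B := ((1 + 2 * R) ^ s.card) ^ 2 * B)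
    (T := R + 2) (p := p) (r := r) (by linarith) hM (by positivity) hga hgc ?_ ?_ ?_ hr hpr hpX
  · have hp : 0 < p := hr.trans hpr
    have hpm : (p : ℂ) ∈ closedRightHalfPlane := by
      simpa [closedRightHalfPlane] using hp.le
    rw [hgg₀ _ hpm, hng₀, Complex.ofReal_re] at key
    have hprod : ‖f p‖ * Real.exp (2 * p * (∑ j ∈ s, (z j).re / ‖z j‖ ^ 2) / (1 + p) ^ 2) ≤
        ‖q p‖ * ∏ j ∈ s, ‖(p : ℂ) + (starRingEnd ℂ) (z j)‖ := by
      rw [hnf, Finset.mul_sum, Finset.sum_div, Real.exp_sum, mul_assoc, ← Finset.prod_mul_distrib]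
      gcongr with j hj
      exact norm_sub_mul_exp_le hp (hre j hj) (hz1 j hj)
    have h2 : ‖f p‖ * Real.exp (2 * p * (∑ j ∈ s, (z j).re / ‖z j‖ ^ 2) / (1 + p) ^ 2) *
        Real.exp (-κ * p) ≤ (1 / r + 1) * (1 + M) :=
      (mul_le_mul_of_nonneg_right hprod (Real.exp_nonneg _)).trans key
    have hfpos : 0 < ‖f p‖ := norm_pos_iff.2 hfp
    have h3 := Real.log_le_log (by positivity) h2
    rw [Real.log_mul (by positivity) (by positivity), Real.log_mul (by positivity) (by positivity),
      Real.log_exp, Real.log_exp] at h3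
    rw [hκ] at h3
    linarith
  · intro y
    refine (lintegral_segment_le 0 y).trans (le_trans (lintegral_mono fun t => ?_) h0)
    rw [hgg₀ _ (hmem 0 t le_rfl), ← ofReal_norm, ← ofReal_norm]
    refine pow_le_pow_left₀ zero_le (ENNReal.ofReal_le_ofReal ?_) 2
    rw [hng₀, hnf, hre', mul_zero, Real.exp_zero, mul_one]
    gcongr with j hj
    refine le_of_sq_le_sq ?_ (norm_nonneg _)
    rw [norm_add_conj_sq, hre']
    simp
  · intro y
    refine (lintegral_segment_le X y).trans ?_
    have hXX : 0 < X ^ X := by positivity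
    calc ∫⁻ t : ℝ, ‖g ((X : ℂ) + (t : ℂ) * Complex.I)‖ₑ ^ 2
        ≤ ∫⁻ t : ℝ, ENNReal.ofReal ((X ^ X)⁻¹ ^ 2) *
            ‖f ((X : ℂ) + (t : ℂ) * Complex.I)‖ₑ ^ 2 := by
          refine lintegral_mono fun t => ?_
          set v : ℂ := (X : ℂ) + (t : ℂ) * Complex.I with hv
          have hvre : v.re = X := hre' X t
          rw [hgg₀ _ (hmem X t (by linarith)), ← ofReal_norm, ← ofReal_norm,
            ← ENNReal.ofReal_pow (norm_nonneg _), ← ENNReal.ofReal_pow (norm_nonneg _),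
            ← ENNReal.ofReal_mul (by positivity), ← mul_pow]
          refine ENNReal.ofReal_le_ofReal ?_
          gcongr
          rw [hng₀, hvre]
          have h4 : ∏ j ∈ s, ‖v + (starRingEnd ℂ) (z j)‖ ≤
              (∏ j ∈ s, ‖v - z j‖) * Real.exp (c * X) := by
            have h5 : c * X = ∑ j ∈ s, 2 * X * (z j).re / D ^ 2 := by
              rw [hc, ← Finset.sum_div, ← Finset.mul_sum]; ring
            rw [h5, Real.exp_sum, ← Finset.prod_mul_distrib]
            refine Finset.prod_le_prod (fun j _ => norm_nonneg _) fun j hj => ?_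
            have h6 := norm_add_conj_le_exp (v := v) (a := z j) (D := D) (by rw [hvre]; linarith)
              (hre j hj).le hDpos ?_
            · rwa [hvre] at h6
            · have h7 := (Complex.re_le_norm (v - z j))
              have h8 := (Complex.re_le_norm (z j)).trans (hzR j hj)
              rw [Complex.sub_re, hvre] at h7
              linarith
          have h9 : Real.exp (-κ * X) = (X ^ X)⁻¹ * (Real.exp (c * X))⁻¹ := by
            rw [Real.rpow_def_of_pos (by linarith), ← Real.exp_neg, ← Real.exp_neg, ← Real.exp_add,
              hκ]
            congr 1; ring
          rw [h9, hnf]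
          calc ‖q v‖ * (∏ j ∈ s, ‖v + (starRingEnd ℂ) (z j)‖) *
                ((X ^ X)⁻¹ * (Real.exp (c * X))⁻¹)
              ≤ ‖q v‖ * ((∏ j ∈ s, ‖v - z j‖) * Real.exp (c * X)) *
                ((X ^ X)⁻¹ * (Real.exp (c * X))⁻¹) := by gcongr
            _ = (X ^ X)⁻¹ * (‖q v‖ * ∏ j ∈ s, ‖v - z j‖) := by
                field_simp
      _ = ENNReal.ofReal ((X ^ X)⁻¹ ^ 2) *
            ∫⁻ t : ℝ, ‖f ((X : ℂ) + (t : ℂ) * Complex.I)‖ₑ ^ 2 := by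
          rw [lintegral_const_mul' _ _ ENNReal.ofReal_ne_top]
      _ ≤ ENNReal.ofReal ((X ^ X)⁻¹ ^ 2) * ENNReal.ofReal (M * (X ^ X) ^ 2) := by gcongr
      _ = ENNReal.ofReal M := by
          rw [← ENNReal.ofReal_mul (by positivity)]
          congr 1
          field_simp
  · intro x hx y hy
    have hpt : ∀ t ∈ Icc (0 : ℝ) 1,
        ‖g ((x : ℂ) + (y : ℂ) * Complex.I + (t : ℂ) * Complex.I)‖ₑ ^ 2 ≤
        ENNReal.ofReal (((1 + 2 * R) ^ s.card) ^ 2) *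
          ‖f ((x : ℂ) + (y : ℂ) * Complex.I + (t : ℂ) * Complex.I)‖ₑ ^ 2 := by
      intro t ht
      have hveq : (x : ℂ) + (y : ℂ) * Complex.I + (t : ℂ) * Complex.I =
          (x : ℂ) + ((y + t : ℝ) : ℂ) * Complex.I := by push_cast; ring
      rw [hveq]
      set v : ℂ := (x : ℂ) + ((y + t : ℝ) : ℂ) * Complex.I with hv
      have hvre : v.re = x := hre' _ _
      have hvim : v.im = y + t := him' _ _
      rw [hgg₀ _ (hmem x _ hx.1.le), ← ofReal_norm, ← ofReal_norm,
        ← ENNReal.ofReal_pow (norm_nonneg _), ← ENNReal.ofReal_pow (norm_nonneg _),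
        ← ENNReal.ofReal_mul (by positivity), ← mul_pow]
      refine ENNReal.ofReal_le_ofReal ?_
      gcongr
      rw [hng₀, hnf, hvre]
      have h4 : ∏ j ∈ s, ‖v + (starRingEnd ℂ) (z j)‖ ≤
          (1 + 2 * R) ^ s.card * ∏ j ∈ s, ‖v - z j‖ := by
        rw [← Finset.prod_const, ← Finset.prod_mul_distrib]
        refine Finset.prod_le_prod (fun j _ => norm_nonneg _) fun j hj => ?_
        -- Since `|y| ≥ R + 2` and `t ≤ 1`, the point is at height at least `R + 1`, clear of all
        -- the zeros.
        have h5 : 1 ≤ ‖v - z j‖ := by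
          have h6 := Complex.abs_im_le_norm (v - z j)
          have h7 := (Complex.abs_im_le_norm (z j)).trans (hzR j hj)
          rw [Complex.sub_im, hvim] at h6
          have h8 : R + 1 ≤ |y + t| := by
            rcases le_abs'.1 hy with h | h
            · rw [le_abs']; left; linarith [ht.2]
            · rw [le_abs']; right; linarith [ht.1]
          have h9 := abs_sub_abs_le_abs_sub (y + t) (z j).im
          linarith
        have h6 : v + (starRingEnd ℂ) (z j) = (v - z j) + ((2 * (z j).re : ℝ) : ℂ) := by
          rw [← Complex.add_conj]; ring
        have h7 : ‖((2 * (z j).re : ℝ) : ℂ)‖ ≤ 2 * R := by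
          rw [Complex.norm_real, Real.norm_of_nonneg (by linarith [hre j hj])]
          linarith [(Complex.re_le_norm (z j)).trans (hzR j hj)]
        calc ‖v + (starRingEnd ℂ) (z j)‖ ≤ ‖v - z j‖ + 2 * R := by
              rw [h6]; exact (norm_add_le _ _).trans (by gcongr)
          _ ≤ (1 + 2 * R) * ‖v - z j‖ := by nlinarith
      have h5 : Real.exp (-κ * x) ≤ 1 := by
        rw [Real.exp_le_one_iff]; nlinarith [hx.1]
      calc ‖q v‖ * (∏ j ∈ s, ‖v + (starRingEnd ℂ) (z j)‖) * Real.exp (-κ * x)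
          ≤ ‖q v‖ * ((1 + 2 * R) ^ s.card * ∏ j ∈ s, ‖v - z j‖) * 1 := by gcongr
        _ = _ := by ring
    refine (setLIntegral_mono' measurableSet_Icc hpt).trans ?_
    rw [lintegral_const_mul' _ _ ENNReal.ofReal_ne_top, ENNReal.ofReal_mul (by positivity)]
    gcongr
    exact (lintegral_segment_le x y).trans (hstrip x hx)

/-! ### The necessary condition. -/

theorem limsup_sum_le {z : ℕ → ℂ} (hz : ∀ j, z j ∈ rightHalfPlane)
    (hz1 : ∀ j, 1 ≤ ‖z j‖) (hzlim : Tendsto (fun j => ‖z j‖) atTop atTop)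
    (hzero : IsZeroSet rightHalfPlane (M2omega ∩ HolClosed) z) :
    limsup (fun R : ℝ =>
        ((1 / Real.log R * ∑ᶠ (j : ℕ) (_ : ‖z j‖ ≤ R), (1 / z j).re : ℝ) : EReal)) atTop
      ≤ ((2 / Real.pi : ℝ) : EReal) := by
  obtain ⟨f, ⟨⟨-, hstrip, hmem⟩, hhol⟩, hord⟩ := hzero
  have hf : AnalyticOnNhd ℂ f closedRightHalfPlane := hhol
  obtain ⟨M, hM, hline⟩ := lintegral_line_le hf.continuousOn hmem
  have hfin : ∀ R : ℝ, {j | ‖z j‖ ≤ R}.Finite := by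
    intro R
    have := hzlim.eventually_gt_atTop R
    rw [← Nat.cofinite_eq_atTop] at this
    simpa using this
  set S : ℝ → ℝ := fun R => ∑ j ∈ (hfin R).toFinset, (z j).re / ‖z j‖ ^ 2 with hS
  have hSeq : ∀ R, ∑ᶠ (j : ℕ) (_ : ‖z j‖ ≤ R), (1 / z j).re = S R := by
    intro R
    refine (finsum_mem_eq_finite_toFinset_sum (fun j => (1 / z j).re) (hfin R)).trans ?_
    refine Finset.sum_congr rfl fun j _ => ?_
    rw [one_div, Complex.inv_re, Complex.normSq_eq_norm_sq]
  -- All zeros in the open half-plane have modulus at least `1`.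
  have hfp : f ((1 / 10 : ℝ) : ℂ) ≠ 0 := by
    have hp : ((1 / 10 : ℝ) : ℂ) ∈ rightHalfPlane := by
      simp only [rightHalfPlane, mem_ofPred_eq, Complex.ofReal_re]; norm_num
    have h1 := hord _ hp
    have h2 : {j : ℕ | z j = ((1 / 10 : ℝ) : ℂ)} = ∅ := by
      ext j
      simp only [mem_ofPred_eq, mem_empty_iff_false, iff_false]
      intro h
      have := hz1 j
      rw [h, Complex.norm_real] at this
      norm_num at this
    rw [h2, encard_empty] at h1
    exact (hf _ (rightHalfPlane_subset hp)).analyticOrderAt_eq_zero.1 h1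
  obtain ⟨C, hC⟩ : ∃ C : ℝ, ∀ R : ℝ, 1 ≤ R → S R ≤ 0.63 * Real.log R + C := by
    set C₀ := Real.log ((1 / (1 / 20 : ℝ) + 1) * (1 + M)) - Real.log ‖f ((1 / 10 : ℝ) : ℂ)‖ with hC₀
    refine ⟨10 * |C₀| + Real.log 12, fun R hR => ?_⟩
    -- `X` must be a half-integer to lie on a line charged by `ω`. With `X - R ≥ 10 R`, the
    -- reflection cost on the right edge contributes at most `S R / 50` to `κ`.
    set n := ⌈22 * R⌉₊ with hn
    set X : ℝ := (n : ℝ) / 2 with hX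
    have hn1 : 22 * R ≤ n := Nat.le_ceil _
    have hn2 : (n : ℝ) < 22 * R + 1 := Nat.ceil_lt_add_one (by linarith)
    have hX1 : 11 * R ≤ X := by rw [hX]; linarith
    have hX2 : X ≤ 12 * R := by rw [hX]; linarith
    obtain ⟨B, hB, hBX⟩ : ∃ B : ℝ, 0 ≤ B ∧ ∀ x ∈ Ioo 0 X,
        ∫⁻ y : ℝ, ‖f ((x : ℂ) + (y : ℂ) * Complex.I)‖ₑ ^ 2 ≤ ENNReal.ofReal B := by
      have h1 := (hstrip X (by linarith)).2
      refine ⟨(⨆ x ∈ Ioo (0 : ℝ) X,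
        ∫⁻ y : ℝ, ‖f ((x : ℂ) + (y : ℂ) * Complex.I)‖ₑ ^ 2).toReal, ENNReal.toReal_nonneg,
        fun x hx => ?_⟩
      rw [ENNReal.ofReal_toReal h1.ne]
      exact le_iSup₂ (f := fun (x : ℝ) (_ : x ∈ Ioo (0 : ℝ) X) =>
        ∫⁻ y : ℝ, ‖f ((x : ℂ) + (y : ℂ) * Complex.I)‖ₑ ^ 2) x hx
    have key := sum_re_div_le (z := z) (s := (hfin R).toFinset) (R := R) (X := X) (M := M) (B := B)
      (p := 1 / 10) (r := 1 / 20) hf (fun j _ => hz j) (fun j _ => hz1 j)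
      (fun j hj => by simpa using hj) ?_ (by linarith) (by linarith) (by linarith) hM hB
      ?_ ?_ hBX (by norm_num) (by norm_num) (by linarith) hfp
    · have hsum : ∑ j ∈ (hfin R).toFinset, (z j).re ≤ R ^ 2 * S R := by
        rw [hS, Finset.mul_sum]
        refine Finset.sum_le_sum fun j hj => ?_
        have h1 : ‖z j‖ ≤ R := by simpa using hj
        have h2 : 0 < (z j).re := hz j
        have h3 := hz1 j
        rw [← mul_div_assoc, le_div_iff₀ (by positivity), mul_comm]
        gcongr
      have hS0 : 0 ≤ S R := Finset.sum_nonneg fun j _ => div_nonneg (le_of_lt (α := ℝ) (hz j))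
        (sq_nonneg _)
      have h1 : 2 * (∑ j ∈ (hfin R).toFinset, (z j).re) / (X - R) ^ 2 ≤ S R / 50 := by
        rw [div_le_iff₀ (by nlinarith)]
        have h2 : 100 * R ^ 2 ≤ (X - R) ^ 2 := by nlinarith
        nlinarith
      have h2 : Real.log X ≤ Real.log 12 + Real.log R := by
        rw [← Real.log_mul (by norm_num) (by linarith)]
        exact Real.log_le_log (by linarith) hX2
      have h3 : 0 ≤ Real.log R := Real.log_nonneg hR
      have h4 : 0 ≤ Real.log 12 := Real.log_nonneg (by norm_num)
      have h5 := le_abs_self C₀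
      have h6 := abs_nonneg C₀
      rw [← hC₀] at key
      have h7 : 2 * (1 / 10) * S R / (1 + 1 / 10) ^ 2 ≤ C₀ + 1 / 10 * (Real.log X + S R / 50) :=
        key.trans (by gcongr)
      -- After division by `p = 1/10`, the coefficient of `S R` is `2 / 1.21 - 0.02 > 1.63`, whose
      -- inverse is below `0.63`.
      norm_num at h7 ⊢
      nlinarith
    · intro w hw
      rw [hord w hw, ← Set.encard_coe_eq_coe_finsetCard]
      refine encard_le_encard fun j hj => ?_
      simp at hj
      exact hj.2
    -- For `n = 0` the convention `0 ^ 0 = 1` turns the line bound into `M`.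
    · simpa using hline 0
    · have h1 := hline n
      rw [show ((X : ℝ) : ℂ) = (n : ℂ) / 2 by rw [hX]; push_cast; rfl]
      rw [← Real.rpow_natCast, ← Real.rpow_mul (by linarith)]
      refine h1.trans (le_of_eq ?_)
      rw [← Real.rpow_natCast]
      congr 3
      push_cast
      ring
  have hπ : 0.635 < 2 / Real.pi := by
    rw [lt_div_iff₀ Real.pi_pos]
    linarith [Real.pi_lt_d4]
  refine limsup_le_of_le (by isBoundedDefault) ?_
  -- `200 C ≤ log R` makes the additive constant cost at most `0.005 log R`, the gap between `0.63`
  -- and `0.635`.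
  filter_upwards [Real.tendsto_log_atTop.eventually_ge_atTop (max 1 (200 * C)),
    eventually_ge_atTop 1] with R hR1 hR2
  have h1 : 1 ≤ Real.log R := (le_max_left _ _).trans hR1
  have h2 : 200 * C ≤ Real.log R := (le_max_right _ _).trans hR1
  rw [hSeq, EReal.coe_le_coe_iff, one_div, inv_mul_le_iff₀ (by linarith)]
  have h3 := hC R hR2
  nlinarith

/-! ### Sums controlled by a linear counting bound, and two real inequalities. -/

/-- In increasing order the `k`-th value is at least `k / c`. The induction removes the largest
value. -/
theorem sum_inv_le_harmonic (m : ℕ → ℝ) {c : ℝ} (hm : ∀ j, 0 < m j) (s : Finset ℕ)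
    (hs : ∀ j ∈ s, ((s.filter fun i => m i ≤ m j).card : ℝ) ≤ c * m j) :
    ∑ j ∈ s, 1 / m j ≤ c * (harmonic s.card : ℝ) := by
  induction s using Finset.induction_on_max_value m with
  | empty => simp
  | insert a s ha hmax ih =>
    have h1 := ih fun j hj => le_trans (by
      exact_mod_cast Finset.card_le_card (Finset.filter_subset_filter _ (Finset.subset_insert a s)))
      (hs j (Finset.mem_insert_of_mem hj))
    have h2 := hs a (Finset.mem_insert_self a s)
    rw [Finset.filter_true_of_mem (by simpa using hmax), Finset.card_insert_of_notMem ha] at h2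
    rw [Finset.sum_insert ha, Finset.card_insert_of_notMem ha, harmonic_succ]
    push_cast at h2 ⊢
    have h3 : 1 / m a ≤ c * ((s.card : ℝ) + 1)⁻¹ := by
      rw [← div_eq_mul_inv, div_le_div_iff₀ (hm a) (by positivity)]
      linarith
    linarith

/-- The `k`-th value is at least both `ρ` and `k / c`, hence at least their average, and `1 / (ρ + k
/ c) ^ 2` is dominated by a telescoping difference. -/
theorem sum_inv_sq_le (m : ℕ → ℝ) {c ρ : ℝ} (hc : 0 < c) (hρ : 0 < ρ) (s : Finset ℕ)
    (hρs : ∀ j ∈ s, ρ ≤ m j)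
    (hs : ∀ j ∈ s, ((s.filter fun i => m i ≤ m j).card : ℝ) ≤ c * m j) :
    ∑ j ∈ s, 1 / m j ^ 2 ≤ 4 * c * (1 / ρ - 1 / (ρ + s.card / c)) := by
  induction s using Finset.induction_on_max_value m with
  | empty => simp
  | insert a s ha hmax ih =>
    have h1 := ih (fun j hj => hρs j (Finset.mem_insert_of_mem hj)) fun j hj => le_trans (by
      exact_mod_cast Finset.card_le_card (Finset.filter_subset_filter _ (Finset.subset_insert a s)))
      (hs j (Finset.mem_insert_of_mem hj))
    have h2 := hs a (Finset.mem_insert_self a s)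
    have h4 := hρs a (Finset.mem_insert_self a s)
    rw [Finset.filter_true_of_mem (by simpa using hmax), Finset.card_insert_of_notMem ha] at h2
    rw [Finset.sum_insert ha, Finset.card_insert_of_notMem ha]
    push_cast at h2 ⊢
    set N : ℝ := (s.card : ℝ)
    have hN : 0 ≤ N := Nat.cast_nonneg _
    have h5 : (N + 1) / c ≤ m a := by rw [div_le_iff₀ hc]; linarith
    have h6 : 0 < ρ + (N + 1) / c := by positivity
    have h7 : 0 < ρ + N / c := by positivity
    have h8 : 1 / m a ^ 2 ≤ 4 / (ρ + (N + 1) / c) ^ 2 := by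
      rw [div_le_div_iff₀ (by have := hρ.trans_le h4; positivity) (by positivity)]
      nlinarith
    have h9 : 4 / (ρ + (N + 1) / c) ^ 2 ≤ 4 * c * (1 / (ρ + N / c) - 1 / (ρ + (N + 1) / c)) := by
      have e : 4 * c * (1 / (ρ + N / c) - 1 / (ρ + (N + 1) / c)) =
          4 / ((ρ + N / c) * (ρ + (N + 1) / c)) := by
        rw [div_sub_div _ _ h7.ne' h6.ne', ← mul_div_assoc]
        congr 1
        field_simp
        ring
      rw [e, sq]
      gcongr
      linarith
    linarith

/-- `|arg w| ≥ |sin (arg w)| = |Im w| / |w|`, and `|w| ≤ Re w + |Im w|`. This is the source of the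
vertical decay of `damping`. -/
theorem abs_im_sub_re_le {w : ℂ} (hw : 0 < w.re) : |w.im| - w.re ≤ w.im * w.arg := by
  have h1 : |w.im| / ‖w‖ ≤ |w.arg| := by
    have := Real.abs_sin_le_abs (x := w.arg)
    rwa [Complex.sin_arg, abs_div, abs_norm] at this
  have h2 : w.im * w.arg = |w.im| * |w.arg| := by
    rcases le_or_gt 0 w.im with h | h
    · rw [abs_of_nonneg h, abs_of_nonneg (Complex.arg_nonneg_iff.2 h)]
    · rw [abs_of_neg h, abs_of_neg (Complex.arg_neg_iff.2 h)]; ring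
  have h3 : ‖w‖ ≤ w.re + |w.im| := by
    have := Complex.norm_le_abs_re_add_abs_im w
    rwa [abs_of_pos hw] at this
  have h4 : 0 < ‖w‖ := hw.trans_le (Complex.re_le_norm w)
  have h5 := abs_nonneg w.im
  rw [h2]
  calc |w.im| - w.re ≤ |w.im| * (|w.im| / ‖w‖) := by
        rw [← mul_div_assoc, le_div_iff₀ h4]
        rcases le_or_gt (|w.im| - w.re) 0 with h | h <;> nlinarith
    _ ≤ _ := by gcongr

theorem mul_log_le {X y ε : ℝ} (hX : 0 < X) (hy : 0 ≤ y) (hε : 0 < ε) (hε1 : ε ≤ 1) :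
    X * Real.log (X + y) ≤ X * Real.log X + ε * y + X * Real.log (1 / ε) := by
  have h0 : X + y = X * ((1 / ε) * (ε * (1 + y / X))) := by field_simp
  have h1 : 0 < ε * (1 + y / X) := by positivity
  have h2 := Real.log_le_sub_one_of_pos h1
  rw [h0, Real.log_mul hX.ne' (by positivity), Real.log_mul (by positivity) h1.ne']
  have h3 : X * Real.log (ε * (1 + y / X)) ≤ X * (ε * (1 + y / X) - 1) := by gcongr
  have h4 : X * (ε * (1 + y / X) - 1) = ε * y + X * (ε - 1) := by
    field_simp
    ring
  nlinarith

/-! ### Elementary factors and their logarithms. -/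

/-- The elementary factor with zero `1 / a` and pole `-1 / conj a`, unimodular on the imaginary
axis. -/
noncomputable def factor (a z : ℂ) : ℂ :=
  (1 - a * z) / (1 + (starRingEnd ℂ) a * z) * Complex.exp (((2 * a.re : ℝ) : ℂ) * z)

theorem norm_one_sub_sq (a z : ℂ) :
    ‖1 - a * z‖ ^ 2 = ‖1 + (starRingEnd ℂ) a * z‖ ^ 2 - 4 * z.re * a.re := by
  simp only [Complex.sq_norm, Complex.normSq_apply, Complex.add_re, Complex.add_im,
    Complex.sub_re, Complex.sub_im, Complex.mul_re, Complex.mul_im, Complex.conj_re,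
    Complex.conj_im, Complex.one_re, Complex.one_im]
  ring

theorem norm_factor (a z : ℂ) : ‖factor a z‖ =
    ‖1 - a * z‖ / ‖1 + (starRingEnd ℂ) a * z‖ * Real.exp (2 * a.re * z.re) := by
  simp [factor, Complex.norm_exp]

theorem norm_factor_le {a z : ℂ} (ha : 0 ≤ a.re) (hz : 0 ≤ z.re) :
    ‖factor a z‖ ≤ Real.exp (2 * z.re * a.re) := by
  rw [norm_factor, show 2 * a.re * z.re = 2 * z.re * a.re by ring]
  refine mul_le_of_le_one_left (Real.exp_nonneg _) (div_le_one_of_le₀ ?_ (norm_nonneg _))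
  refine le_of_sq_le_sq ?_ (norm_nonneg _)
  rw [norm_one_sub_sq]
  nlinarith [mul_nonneg ha hz]

/-- With `N = |1 + conj a z|`, the Blaschke quotient contributes at most `exp (-4 Re z Re a / N ^
2)` to the squared modulus and the exponential factor `exp (4 Re z Re a)`. They nearly cancel, since
`1 - 1 / N ^ 2 = O(|a z|)`. -/
theorem norm_factor_le_of_small {a z : ℂ} (ha : 0 ≤ a.re) (hz : 0 ≤ z.re)
    (h : ‖a‖ * ‖z‖ ≤ 1 / 2) : ‖factor a z‖ ≤ Real.exp (20 * z.re * (‖z‖ * ‖a‖ ^ 2)) := by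
  refine le_of_sq_le_sq ?_ (Real.exp_nonneg _)
  rw [norm_factor, mul_pow, div_pow, norm_one_sub_sq, ← Real.exp_nat_mul, ← Real.exp_nat_mul]
  set N := ‖1 + (starRingEnd ℂ) a * z‖
  have hw : ‖(starRingEnd ℂ) a * z‖ = ‖a‖ * ‖z‖ := by rw [norm_mul, RCLike.norm_conj]
  have hw0 : 0 ≤ ‖a‖ * ‖z‖ := by positivity
  have hN1 : 1 / 2 ≤ N := by
    have := norm_sub_le_norm_add (1 : ℂ) ((starRingEnd ℂ) a * z)
    rw [hw, norm_one] at this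
    linarith
  have hN2 : N ≤ 1 + ‖a‖ * ‖z‖ := by
    have := norm_add_le (1 : ℂ) ((starRingEnd ℂ) a * z)
    rwa [hw, norm_one] at this
  have hN : 0 < N ^ 2 := by positivity
  have h1 : (N ^ 2 - 4 * z.re * a.re) / N ^ 2 ≤ Real.exp (-(4 * z.re * a.re / N ^ 2)) := by
    have := Real.add_one_le_exp (-(4 * z.re * a.re / N ^ 2))
    rw [sub_div, div_self hN.ne']
    linarith
  have h2 : 1 - 1 / N ^ 2 ≤ 10 * (‖a‖ * ‖z‖) := by
    rw [sub_le_iff_le_add, ← sub_le_iff_le_add', le_div_iff₀ hN]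
    set w := ‖a‖ * ‖z‖
    rcases le_or_gt (1 - 10 * w) 0 with h' | h'
    · nlinarith
    · calc (1 - 10 * w) * N ^ 2 ≤ (1 - 10 * w) * (1 + w) ^ 2 := by gcongr
        _ = 1 - (8 * w + 19 * w ^ 2 + 10 * w ^ 3) := by ring
        _ ≤ 1 := by
          have : 0 ≤ 8 * w + 19 * w ^ 2 + 10 * w ^ 3 := by positivity
          linarith
  have h3 : a.re ≤ ‖a‖ := Complex.re_le_norm a
  refine (mul_le_mul_of_nonneg_right h1 (Real.exp_nonneg _)).trans ?_
  rw [← Real.exp_add]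
  refine Real.exp_le_exp.2 ?_
  push_cast
  calc -(4 * z.re * a.re / N ^ 2) + 2 * (2 * a.re * z.re)
      = 4 * z.re * (a.re * (1 - 1 / N ^ 2)) := by ring
    _ ≤ 4 * z.re * (a.re * (10 * (‖a‖ * ‖z‖))) := by gcongr
    _ ≤ 4 * z.re * (‖a‖ * (10 * (‖a‖ * ‖z‖))) := by gcongr
    _ = 2 * (20 * z.re * (‖z‖ * ‖a‖ ^ 2)) := by ring

/-- The logarithm of `factor a`, near the origin. -/
noncomputable def logFactor (a z : ℂ) : ℂ :=
  Complex.log (1 + -(a * z)) - Complex.log (1 + (starRingEnd ℂ) a * z) + ((2 * a.re : ℝ) : ℂ) * z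

theorem one_add_ne_zero {w : ℂ} (hw : ‖w‖ < 1) : 1 + w ≠ 0 :=
  Complex.slitPlane_ne_zero (Complex.mem_slitPlane_of_norm_lt_one hw)

theorem exp_logFactor {a z : ℂ} (h : ‖a‖ * ‖z‖ < 1) : Complex.exp (logFactor a z) = factor a z := by
  have h1 : ‖-(a * z)‖ < 1 := by rwa [norm_neg, norm_mul]
  have h2 : ‖(starRingEnd ℂ) a * z‖ < 1 := by rwa [norm_mul, RCLike.norm_conj]
  rw [logFactor, Complex.exp_add, Complex.exp_sub, Complex.exp_log (one_add_ne_zero h1),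
    Complex.exp_log (one_add_ne_zero h2), factor, sub_eq_add_neg]

/-- The linear terms `-a z` and `-conj a z` of the two logarithms cancel against `2 Re a z`, leaving
quadratic remainders. -/
theorem norm_logFactor_le {a z : ℂ} (h : ‖a‖ * ‖z‖ ≤ 1 / 2) :
    ‖logFactor a z‖ ≤ 2 * (‖a‖ * ‖z‖) ^ 2 := by
  have h1 : ‖-(a * z)‖ = ‖a‖ * ‖z‖ := by rw [norm_neg, norm_mul]
  have h2 : ‖(starRingEnd ℂ) a * z‖ = ‖a‖ * ‖z‖ := by rw [norm_mul, RCLike.norm_conj]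
  have key : ∀ w : ℂ, ‖w‖ = ‖a‖ * ‖z‖ → ‖Complex.log (1 + w) - w‖ ≤ (‖a‖ * ‖z‖) ^ 2 := by
    intro w hw
    refine (Complex.norm_log_one_add_sub_self_le (by rw [hw]; linarith)).trans ?_
    rw [hw]
    have h3 : (1 - ‖a‖ * ‖z‖)⁻¹ ≤ 2 := by
      rw [inv_le_comm₀ (by linarith) (by norm_num)]; linarith
    nlinarith [sq_nonneg (‖a‖ * ‖z‖)]
  have e : logFactor a z = (Complex.log (1 + -(a * z)) - -(a * z)) -
      (Complex.log (1 + (starRingEnd ℂ) a * z) - (starRingEnd ℂ) a * z) := by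
    rw [logFactor, ← Complex.add_conj]; ring
  rw [e]
  refine (norm_sub_le _ _).trans ?_
  linarith [key _ h1, key _ h2]

theorem differentiableAt_logFactor {a z : ℂ} (h : ‖a‖ * ‖z‖ < 1) :
    DifferentiableAt ℂ (logFactor a) z := by
  have h1 : ‖-(a * z)‖ < 1 := by rwa [norm_neg, norm_mul]
  have h2 : ‖(starRingEnd ℂ) a * z‖ < 1 := by rwa [norm_mul, RCLike.norm_conj]
  have d1 : DifferentiableAt ℂ (fun v : ℂ => Complex.log (1 + -(a * v))) z :=
    DifferentiableAt.clog (by fun_prop) (Complex.mem_slitPlane_of_norm_lt_one h1)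
  have d2 : DifferentiableAt ℂ (fun v : ℂ => Complex.log (1 + (starRingEnd ℂ) a * v)) z :=
    DifferentiableAt.clog (by fun_prop) (Complex.mem_slitPlane_of_norm_lt_one h2)
  exact (d1.sub d2).add (by fun_prop)

theorem one_add_conj_inv_mul_ne_zero {a w : ℂ} (ha : 0 < a.re) (hw : 0 ≤ w.re) :
    1 + (starRingEnd ℂ) a⁻¹ * w ≠ 0 := by
  intro h
  have ha' : (starRingEnd ℂ) a ≠ 0 := by
    intro h0
    have := congrArg Complex.re h0
    simp at this
    linarith
  have h1 : (starRingEnd ℂ) a + w = 0 := by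
    rw [map_inv₀] at h
    have := congrArg ((starRingEnd ℂ) a * ·) h
    simpa [mul_add, mul_inv_cancel_left₀ ha'] using this
  have h2 := congrArg Complex.re h1
  simp at h2
  linarith

theorem analyticAt_factor {a w : ℂ} (ha : 0 < a.re) (hw : 0 ≤ w.re) :
    AnalyticAt ℂ (factor a⁻¹) w := by
  unfold factor
  refine AnalyticAt.mul (AnalyticAt.div (by fun_prop) (by fun_prop)
    (one_add_conj_inv_mul_ne_zero ha hw)) (by fun_prop)

theorem analyticOrderAt_factor {a w : ℂ} (ha : 0 < a.re) (hw : 0 ≤ w.re) :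
    analyticOrderAt (factor a⁻¹) w = if a = w then 1 else 0 := by
  have ha0 : a ≠ 0 := by rintro rfl; simp at ha
  have hne := one_add_conj_inv_mul_ne_zero ha hw
  set u : ℂ → ℂ := fun v => -a⁻¹ / (1 + (starRingEnd ℂ) a⁻¹ * v) *
    Complex.exp (((2 * a⁻¹.re : ℝ) : ℂ) * v) with hu
  have hfac : factor a⁻¹ = (fun v => v - a) * u := by
    funext v
    simp only [factor, hu, Pi.mul_apply]
    rw [show 1 - a⁻¹ * v = (v - a) * -a⁻¹ by field_simp; ring]
    ring
  have hua : AnalyticAt ℂ u w :=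
    AnalyticAt.mul (AnalyticAt.div (by fun_prop) (by fun_prop) hne) (by fun_prop)
  have hu0 : analyticOrderAt u w = 0 := by
    rw [hua.analyticOrderAt_eq_zero]
    exact mul_ne_zero (div_ne_zero (neg_ne_zero.2 (inv_ne_zero ha0)) hne) (Complex.exp_ne_zero _)
  rw [hfac, analyticOrderAt_mul (by fun_prop) hua, hu0, add_zero]
  split_ifs with h
  · rw [h]; exact analyticOrderAt_id_sub_const_self
  · exact analyticOrderAt_id_sub_const_of_ne (Ne.symm h)

/-! ### The canonical product: convergence, zeros and growth. -/

/-- The product of the elementary factors of the sequence `z`. -/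
noncomputable def canonicalProduct (z : ℕ → ℂ) (v : ℂ) : ℂ := ∏' j, factor (z j)⁻¹ v

/-- The logarithms of the factors outside the finite set `s`. -/
noncomputable def tailLog (z : ℕ → ℂ) (s : Finset ℕ) (j : ℕ) (v : ℂ) : ℂ :=
  if j ∈ s then 0 else logFactor (z j)⁻¹ v

theorem norm_tailLog_le {z : ℕ → ℂ} (hz1 : ∀ j, 1 ≤ ‖z j‖) {s : Finset ℕ} {ρ : ℝ}
    (hs : ∀ j ∉ s, 2 * ρ ≤ ‖z j‖) {v : ℂ} (hv : ‖v‖ ≤ ρ) (j : ℕ) :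
    ‖tailLog z s j v‖ ≤ 2 * ρ ^ 2 * (1 / ‖z j‖ ^ 2) := by
  have hρ : 0 ≤ ρ := (norm_nonneg v).trans hv
  have hzj := hz1 j
  unfold tailLog
  split_ifs with h
  · rw [norm_zero]; positivity
  · have h1 : ‖(z j)⁻¹‖ * ‖v‖ ≤ 1 / 2 := by
      rw [norm_inv, inv_mul_le_iff₀ (by linarith)]
      linarith [hs j h]
    refine (norm_logFactor_le h1).trans ?_
    rw [norm_inv, mul_pow, inv_pow, one_div]
    have : ‖v‖ ^ 2 ≤ ρ ^ 2 := by gcongr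
    calc 2 * ((‖z j‖ ^ 2)⁻¹ * ‖v‖ ^ 2) ≤ 2 * ((‖z j‖ ^ 2)⁻¹ * ρ ^ 2) := by gcongr
      _ = _ := by ring

theorem hasProd_factor {z : ℕ → ℂ} (hz1 : ∀ j, 1 ≤ ‖z j‖)
    (hsum : Summable fun j => 1 / ‖z j‖ ^ 2) {s : Finset ℕ} {ρ : ℝ}
    (hs : ∀ j ∉ s, 2 * ρ ≤ ‖z j‖) {v : ℂ} (hv : ‖v‖ ≤ ρ) :
    HasProd (fun j => factor (z j)⁻¹ v)
      ((∏ j ∈ s, factor (z j)⁻¹ v) * Complex.exp (∑' j, tailLog z s j v)) := by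
  have hsm : Summable fun j => tailLog z s j v :=
    Summable.of_norm_bounded (hsum.mul_left (2 * ρ ^ 2)) (norm_tailLog_le hz1 hs hv)
  have h1 := hsm.hasSum.cexp
  have h2 : HasProd (fun j => if j ∈ s then factor (z j)⁻¹ v else 1)
      (∏ j ∈ s, factor (z j)⁻¹ v) := by
    have := hasProd_prod_of_ne_finset_one (f := fun j => if j ∈ s then factor (z j)⁻¹ v else 1)
      (s := s) (L := SummationFilter.unconditional ℕ) (fun j hj => if_neg hj)
    rwa [Finset.prod_congr rfl (fun j hj => if_pos hj)] at this
  refine (h2.mul h1).congr_fun ?_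
  intro j
  by_cases h : j ∈ s
  · simp [tailLog, h]
  · have hzj := hz1 j
    have h3 : ‖(z j)⁻¹‖ * ‖v‖ < 1 := by
      rw [norm_inv, inv_mul_lt_iff₀ (by linarith)]
      linarith [hs j h]
    simp [tailLog, h, exp_logFactor h3]

theorem analyticOrderAt_prod_factor {z : ℕ → ℂ} (hz : ∀ j, 0 < (z j).re) {w : ℂ} (hw : 0 ≤ w.re)
    (s : Finset ℕ) :
    analyticOrderAt (fun v => ∏ j ∈ s, factor (z j)⁻¹ v) w = (s.filter (z · = w)).card := by
  induction s using Finset.induction_on with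
  | empty =>
    simp only [Finset.prod_empty, Finset.filter_empty, Finset.card_empty, Nat.cast_zero]
    exact (analyticAt_const.analyticOrderAt_eq_zero).2 one_ne_zero
  | insert a s ha ih =>
    have h1 : (fun v => ∏ j ∈ insert a s, factor (z j)⁻¹ v) =
        factor (z a)⁻¹ * fun v => ∏ j ∈ s, factor (z j)⁻¹ v := by
      funext v
      simp [Finset.prod_insert ha]
    rw [h1, analyticOrderAt_mul (analyticAt_factor (hz a) hw)
      (Finset.analyticAt_fun_prod _ fun j _ => analyticAt_factor (hz j) hw), ih,
      analyticOrderAt_factor (hz a) hw, Finset.filter_insert]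
    split_ifs with h
    · rw [Finset.card_insert_of_notMem (by simp [ha])]
      push_cast
      rw [add_comm]
    · rw [zero_add]

/-- Near `w` the product is a finite product times the exponential of a normally convergent series.
The second factor has no zeros, so all multiplicity comes from the first. -/
theorem canonicalProduct_analytic {z : ℕ → ℂ} (hz : ∀ j, 0 < (z j).re) (hz1 : ∀ j, 1 ≤ ‖z j‖)
    (hsum : Summable fun j => 1 / ‖z j‖ ^ 2) (hfin : ∀ R : ℝ, {j | ‖z j‖ ≤ R}.Finite)
    {w : ℂ} (hw : 0 ≤ w.re) :
    AnalyticAt ℂ (canonicalProduct z) w ∧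
      analyticOrderAt (canonicalProduct z) w = Set.encard {j | z j = w} := by
  set ρ := ‖w‖ + 1 with hρ
  set s := (hfin (2 * ρ)).toFinset with hs
  have hs' : ∀ j ∉ s, 2 * ρ ≤ ‖z j‖ := by
    intro j hj
    simp only [hs, Finite.mem_toFinset, mem_ofPred_eq, not_le] at hj
    exact hj.le
  have hball : Metric.ball (0 : ℂ) ρ ∈ 𝓝 w := Metric.isOpen_ball.mem_nhds (by simp [hρ])
  have heq : (fun v => (∏ j ∈ s, factor (z j)⁻¹ v) * Complex.exp (∑' j, tailLog z s j v))
      =ᶠ[𝓝 w] canonicalProduct z := by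
    filter_upwards [hball] with v hv
    exact (hasProd_factor hz1 hsum hs' (mem_ball_zero_iff.1 hv).le).tprod_eq.symm
  have htail : AnalyticAt ℂ (fun v => ∑' j, tailLog z s j v) w := by
    refine DifferentiableOn.analyticAt (s := Metric.ball 0 ρ) ?_ hball
    refine Complex.differentiableOn_tsum_of_summable_norm (hsum.mul_left (2 * ρ ^ 2)) ?_
      Metric.isOpen_ball ?_
    · intro j v hv
      by_cases h : j ∈ s
      · have e : tailLog z s j = fun _ => 0 := funext fun _ => if_pos h
        rw [e]
        exact differentiableWithinAt_const _
      · have e : tailLog z s j = logFactor (z j)⁻¹ := funext fun _ => if_neg h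
        rw [e]
        refine (differentiableAt_logFactor ?_).differentiableWithinAt
        have hv' : ‖v‖ < ρ := by simpa using hv
        have hzj := hz1 j
        rw [norm_inv, inv_mul_lt_iff₀ (by linarith)]
        linarith [hs' j h, norm_nonneg v]
    · intro j v hv
      exact norm_tailLog_le hz1 hs' (by simpa using (Metric.mem_ball.1 hv).le) j
  have hprod : AnalyticAt ℂ (fun v => ∏ j ∈ s, factor (z j)⁻¹ v) w :=
    Finset.analyticAt_fun_prod _ fun j _ => analyticAt_factor (hz j) hw
  refine ⟨(hprod.mul htail.cexp).congr heq, ?_⟩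
  rw [← analyticOrderAt_congr heq]
  have h0 : analyticOrderAt (fun v => Complex.exp (∑' j, tailLog z s j v)) w = 0 :=
    htail.cexp.analyticOrderAt_eq_zero.2 (Complex.exp_ne_zero _)
  have hexp : AnalyticAt ℂ (fun v => Complex.exp (∑' j, tailLog z s j v)) w := htail.cexp
  have h1 := analyticOrderAt_mul hprod hexp
  rw [h0, add_zero, analyticOrderAt_prod_factor hz hw] at h1
  refine Eq.trans h1 ?_
  rw [← Set.encard_coe_eq_coe_finsetCard]
  congr 1
  ext j
  simp only [Finset.coe_filter, hs, Finite.mem_toFinset, mem_ofPred_eq, and_iff_right_iff_imp]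
  rintro rfl
  linarith [norm_nonneg (z j)]

theorem norm_canonicalProduct_le {z : ℕ → ℂ} (hz1 : ∀ j, 1 ≤ ‖z j‖)
    (hsum : Summable fun j => 1 / ‖z j‖ ^ 2) (hfin : ∀ R : ℝ, {j | ‖z j‖ ≤ R}.Finite)
    {v : ℂ} {K : ℝ} (hK : ∀ t : Finset ℕ, ‖∏ j ∈ t, factor (z j)⁻¹ v‖ ≤ K) :
    ‖canonicalProduct z v‖ ≤ K := by
  have h := hasProd_factor hz1 hsum (s := (hfin (2 * ‖v‖)).toFinset) (ρ := ‖v‖) (v := v)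
    (fun j hj => by
      simp only [Finite.mem_toFinset, mem_ofPred_eq, not_le] at hj
      exact hj.le) le_rfl
  rw [canonicalProduct, h.tprod_eq]
  exact le_of_tendsto h.norm (Eventually.of_forall fun t => by simpa using hK t)

theorem sum_re_inv_le {z : ℕ → ℂ} (hz1 : ∀ j, 1 ≤ ‖z j‖)
    (hfin : ∀ R : ℝ, {j | ‖z j‖ ≤ R}.Finite) {c r₀ ρ : ℝ} (hc0 : 0 < c) (hc1 : c ≤ 1)
    (hr₀ : 1 ≤ r₀) (hcount : ∀ r, r₀ ≤ r → (countingFunction z r : ℝ) ≤ c * r) (hρ : r₀ ≤ ρ)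
    (t : Finset ℕ) (ht : ∀ j ∈ t, ‖z j‖ ≤ ρ) :
    ∑ j ∈ t, 1 / ‖z j‖ ≤ c * Real.log ρ + (r₀ + 1) := by
  have hcard : ∀ (u : Finset ℕ) (r : ℝ), r₀ ≤ r → (∀ j ∈ u, ‖z j‖ ≤ r) → (u.card : ℝ) ≤ c * r := by
    intro u r hr hu
    refine le_trans ?_ (hcount r hr)
    rw [countingFunction, ← Set.ncard_coe_finset]
    exact_mod_cast Set.ncard_le_ncard (fun j hj => hu j hj) (hfin r)
  rw [← Finset.sum_filter_add_sum_filter_not t (fun j => ‖z j‖ ≤ r₀)]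
  have h1 : ∑ j ∈ t.filter (fun j => ‖z j‖ ≤ r₀), 1 / ‖z j‖ ≤ r₀ := by
    calc _ ≤ ∑ j ∈ t.filter (fun j => ‖z j‖ ≤ r₀), (1 : ℝ) := by
          refine Finset.sum_le_sum fun j _ => ?_
          have := hz1 j
          rw [div_le_one (by linarith)]
          exact this
      _ = ((t.filter (fun j => ‖z j‖ ≤ r₀)).card : ℝ) := by simp
      _ ≤ c * r₀ := hcard _ _ le_rfl (by simp)
      _ ≤ r₀ := by nlinarith
  set u := t.filter (fun j => ¬ ‖z j‖ ≤ r₀) with hu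
  have hur : ∀ j ∈ u, r₀ ≤ ‖z j‖ := by
    intro j hj
    simp only [hu, Finset.mem_filter, not_le] at hj
    exact hj.2.le
  have h2 := sum_inv_le_harmonic (fun j => ‖z j‖) (c := c)
    (fun j => zero_lt_one.trans_le (hz1 j)) u (fun j hj => hcard _ _ (hur j hj) (by simp))
  have h3 : (harmonic u.card : ℝ) ≤ 1 + Real.log ρ := by
    refine (harmonic_le_one_add_log _).trans ?_
    refine add_le_add le_rfl ?_
    rcases Nat.eq_zero_or_pos u.card with h | h
    · rw [h]; simp; exact Real.log_nonneg (hr₀.trans hρ)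
    · refine Real.log_le_log (by exact_mod_cast h) ?_
      have := hcard u ρ hρ fun j hj => ht j (Finset.mem_of_mem_filter j hj)
      nlinarith
  have h4 : c * (harmonic u.card : ℝ) ≤ c * (1 + Real.log ρ) := by gcongr
  linarith

/-- The zeros are split at modulus `2 |v| + r₀`. The near ones contribute through `∑ 1 / |z j|`, a
harmonic sum giving the logarithm; the far ones through `|v| ∑ 1 / |z j| ^ 2`, which is bounded. -/
theorem norm_canonicalProduct_le_exp {z : ℕ → ℂ} (hz : ∀ j, 0 < (z j).re)
    (hz1 : ∀ j, 1 ≤ ‖z j‖) (hsum : Summable fun j => 1 / ‖z j‖ ^ 2)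
    (hfin : ∀ R : ℝ, {j | ‖z j‖ ≤ R}.Finite) {c r₀ : ℝ} (hc0 : 0 < c) (hc1 : c ≤ 1)
    (hr₀ : 1 ≤ r₀) (hcount : ∀ r, r₀ ≤ r → (countingFunction z r : ℝ) ≤ c * r)
    {v : ℂ} (hv : 0 ≤ v.re) :
    ‖canonicalProduct z v‖ ≤
      Real.exp (2 * v.re * (c * Real.log (2 * ‖v‖ + r₀) + (r₀ + 21))) := by
  refine norm_canonicalProduct_le hz1 hsum hfin fun t => ?_
  set ρ := 2 * ‖v‖ + r₀ with hρ
  have hvn := norm_nonneg v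
  have hρ0 : 0 < ρ := by positivity
  have hzre : ∀ j, 0 ≤ (z j)⁻¹.re := fun j => by
    rw [Complex.inv_re]; exact div_nonneg (hz j).le (Complex.normSq_nonneg _)
  rw [← Finset.prod_filter_mul_prod_filter_not t (fun j => ‖z j‖ ≤ ρ), norm_mul]
  have h1 : ‖∏ j ∈ t.filter (fun j => ‖z j‖ ≤ ρ), factor (z j)⁻¹ v‖ ≤
      Real.exp (2 * v.re * (c * Real.log ρ + (r₀ + 1))) := by
    rw [norm_prod]
    calc _ ≤ ∏ j ∈ t.filter (fun j => ‖z j‖ ≤ ρ), Real.exp (2 * v.re * (1 / ‖z j‖)) := by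
          refine Finset.prod_le_prod (fun _ _ => norm_nonneg _) fun j _ => ?_
          refine (norm_factor_le (hzre j) hv).trans ?_
          gcongr
          rw [one_div, ← norm_inv]
          exact Complex.re_le_norm _
      _ = Real.exp (2 * v.re * ∑ j ∈ t.filter (fun j => ‖z j‖ ≤ ρ), 1 / ‖z j‖) := by
          rw [← Real.exp_sum, Finset.mul_sum]
      _ ≤ _ := by
          gcongr
          exact sum_re_inv_le hz1 hfin hc0 hc1 hr₀ hcount (by linarith) _ (by simp)
  have h2 : ‖∏ j ∈ t.filter (fun j => ¬ ‖z j‖ ≤ ρ), factor (z j)⁻¹ v‖ ≤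
      Real.exp (2 * v.re * 20) := by
    set u := t.filter (fun j => ¬ ‖z j‖ ≤ ρ) with hu
    have hur : ∀ j ∈ u, ρ ≤ ‖z j‖ := by
      intro j hj
      simp only [hu, Finset.mem_filter, not_le] at hj
      exact hj.2.le
    have h3 : ∑ j ∈ u, 1 / ‖z j‖ ^ 2 ≤ 4 * c * (1 / ρ) := by
      refine (sum_inv_sq_le (fun j => ‖z j‖) hc0 hρ0 u hur fun j hj => ?_).trans ?_
      · refine le_trans ?_ (hcount ‖z j‖ (by linarith [hur j hj]))
        rw [countingFunction, ← Set.ncard_coe_finset]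
        refine Nat.cast_le.2 (Set.ncard_le_ncard (fun i hi => ?_) (hfin _))
        exact (Finset.mem_filter.1 hi).2
      · gcongr
        have : 0 ≤ 1 / (ρ + u.card / c) := by positivity
        linarith
    have h4 : ‖v‖ * ∑ j ∈ u, 1 / ‖z j‖ ^ 2 ≤ 2 := by
      calc _ ≤ ‖v‖ * (4 * c * (1 / ρ)) := by gcongr
        _ = 4 * c * ‖v‖ / ρ := by ring
        _ ≤ 2 := by rw [div_le_iff₀ hρ0]; nlinarith
    rw [norm_prod]
    calc _ ≤ ∏ j ∈ u, Real.exp (20 * v.re * (‖v‖ * (1 / ‖z j‖ ^ 2))) := by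
          refine Finset.prod_le_prod (fun _ _ => norm_nonneg _) fun j hj => ?_
          have h5 : ‖(z j)⁻¹‖ * ‖v‖ ≤ 1 / 2 := by
            have := hz1 j
            rw [norm_inv, inv_mul_le_iff₀ (by linarith)]
            linarith [hur j hj]
          refine (norm_factor_le_of_small (hzre j) hv h5).trans (le_of_eq ?_)
          rw [norm_inv, inv_pow, one_div]
      _ = Real.exp (20 * v.re * (‖v‖ * ∑ j ∈ u, 1 / ‖z j‖ ^ 2)) := by
          rw [← Real.exp_sum, Finset.mul_sum, Finset.mul_sum]
      _ ≤ Real.exp (20 * v.re * 2) := by gcongr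
      _ = _ := by congr 1; ring
  refine (mul_le_mul h1 h2 (norm_nonneg _) (Real.exp_nonneg _)).trans (le_of_eq ?_)
  rw [← Real.exp_add]
  congr 1
  ring

/-! ### A growth condition for membership in `ℳ²_ω`. -/

theorem summable_omega_weights {β C : ℝ} (hβ0 : 0 ≤ β) (hβ : β < 1) :
    Summable fun n : ℕ => 2 ^ n / (n.factorial : ℝ) *
      Real.exp (2 * (β * (((n : ℝ) / 2 + 1) * Real.log ((n : ℝ) / 2 + 1)) +
        C * ((n : ℝ) / 2 + 1))) := by
  refine Summable.of_norm_bounded_eventually_nat Real.summable_exp_neg_nat ?_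
  have hlim : Tendsto (fun n : ℕ => (1 - β) * Real.log ((n : ℝ) + 1)) atTop atTop :=
    (Real.tendsto_log_atTop.comp
      (tendsto_atTop_add_const_right _ _ tendsto_natCast_atTop_atTop)).const_mul_atTop
      (by linarith)
  -- Beyond `-(1 - β) n L`, the exponent is at most `2 n + 1 + 2 β L + |C| (n + 2) ≤ (5 + 3 |C|) n`;
  -- the constant `6 + 3 |C|` leaves `-n`.
  filter_upwards [hlim.eventually_ge_atTop (6 + 3 * |C|), eventually_ge_atTop 1] with n hn hn1
  have hn1' : (1 : ℝ) ≤ n := by exact_mod_cast hn1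
  set L := Real.log ((n : ℝ) + 1) with hL
  have hL0 : 0 ≤ L := Real.log_nonneg (by linarith)
  have hLn : L ≤ n := by
    have := Real.log_le_sub_one_of_pos (x := (n : ℝ) + 1) (by linarith)
    linarith
  have h2 : (2 : ℝ) ^ n ≤ Real.exp n := by
    have h3 : (2 : ℝ) ≤ Real.exp 1 := by
      have := Real.add_one_le_exp (1 : ℝ); linarith
    calc (2 : ℝ) ^ n ≤ Real.exp 1 ^ n := by gcongr
      _ = Real.exp n := by rw [← Real.exp_nat_mul, mul_one]
  have h4 : 1 / (n.factorial : ℝ) ≤ Real.exp (n + 1 - n * L) := by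
    have h5 := Real.pow_div_factorial_le_exp ((n : ℝ) + 1) (by linarith) n
    have h6 : ((n : ℝ) + 1) ^ n = Real.exp (n * L) := by
      rw [hL, Real.exp_nat_mul, Real.exp_log (by linarith)]
    rw [h6] at h5
    rw [Real.exp_sub, le_div_iff₀ (Real.exp_pos _)]
    calc 1 / (n.factorial : ℝ) * Real.exp (n * L) = Real.exp (n * L) / n.factorial := by ring
      _ ≤ _ := h5
  have h7 : Real.log ((n : ℝ) / 2 + 1) ≤ L := Real.log_le_log (by positivity) (by linarith)
  have hC := le_abs_self C
  have hC0 := abs_nonneg C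
  rw [Real.norm_of_nonneg (by positivity), div_eq_mul_one_div]
  calc (2 : ℝ) ^ n * (1 / (n.factorial : ℝ)) *
        Real.exp (2 * (β * (((n : ℝ) / 2 + 1) * Real.log ((n : ℝ) / 2 + 1)) +
          C * ((n : ℝ) / 2 + 1)))
      ≤ Real.exp n * Real.exp (n + 1 - n * L) *
        Real.exp (2 * (β * (((n : ℝ) / 2 + 1) * L) + |C| * ((n : ℝ) / 2 + 1))) := by gcongr
    _ = Real.exp (n + (n + 1 - n * L) +
        2 * (β * (((n : ℝ) / 2 + 1) * L) + |C| * ((n : ℝ) / 2 + 1))) := by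
        rw [Real.exp_add, Real.exp_add]
    _ ≤ Real.exp (-n) := by
        refine Real.exp_le_exp.2 ?_
        have h8 : (6 + 3 * |C|) * n ≤ (1 - β) * L * n := by gcongr
        have h9 : β * L ≤ n := by nlinarith
        nlinarith

theorem lintegral_exp_neg_abs_lt_top {k : ℝ} (hk : 0 < k) :
    ∫⁻ y : ℝ, ENNReal.ofReal (Real.exp (-(k * |y|))) < ⊤ := by
  have h1 : Integrable (fun y : ℝ => (1 + 2 / k ^ 2) * (1 + y ^ 2)⁻¹) :=
    integrable_inv_one_add_sq.const_mul _
  refine lt_of_le_of_lt (lintegral_mono fun y => ?_) h1.lintegral_lt_top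
  refine ENNReal.ofReal_le_ofReal ?_
  have h2 := Real.quadratic_le_exp_of_nonneg (x := k * |y|) (by positivity)
  rw [Real.exp_neg, ← div_eq_mul_inv, inv_eq_one_div,
    div_le_div_iff₀ (Real.exp_pos _) (by positivity)]
  have h3 : (k * |y|) ^ 2 = k ^ 2 * y ^ 2 := by rw [mul_pow, sq_abs]
  have h4 : 0 ≤ k * |y| := by positivity
  have h5 : (1 + 2 / k ^ 2) * (k ^ 2 * y ^ 2 / 2) = k ^ 2 * y ^ 2 / 2 + y ^ 2 := by field_simp
  have h6 : 0 ≤ 2 / k ^ 2 := by positivity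
  have h7 : 0 ≤ k ^ 2 * y ^ 2 / 2 := by positivity
  calc 1 * (1 + y ^ 2) ≤ (1 + 2 / k ^ 2) * (1 + k ^ 2 * y ^ 2 / 2) := by linarith
    _ ≤ (1 + 2 / k ^ 2) * Real.exp (k * |y|) := by
        gcongr
        linarith

theorem lintegral_line_le_of_norm_le {f : ℂ → ℂ} {x A k : ℝ}
    (h : ∀ y : ℝ, ‖f ((x : ℂ) + (y : ℂ) * Complex.I)‖ ≤ Real.exp (A - k * |y|)) :
    ∫⁻ y : ℝ, ‖f ((x : ℂ) + (y : ℂ) * Complex.I)‖ₑ ^ 2 ≤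
      ENNReal.ofReal (Real.exp (2 * A)) *
        ∫⁻ y : ℝ, ENNReal.ofReal (Real.exp (-(2 * k * |y|))) := by
  rw [← lintegral_const_mul' _ _ ENNReal.ofReal_ne_top]
  refine lintegral_mono fun y => ?_
  rw [← ofReal_norm, ← ENNReal.ofReal_pow (norm_nonneg _),
    ← ENNReal.ofReal_mul (Real.exp_nonneg _), ← Real.exp_add]
  refine ENNReal.ofReal_le_ofReal ?_
  calc _ ≤ Real.exp (A - k * |y|) ^ 2 := by gcongr; exact h y
    _ = _ := by rw [← Real.exp_nat_mul]; congr 1; push_cast; ring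

theorem mem_M2omega_of_norm_le {f : ℂ → ℂ} (hf : AnalyticOnNhd ℂ f closedRightHalfPlane)
    {β C k : ℝ} (hβ0 : 0 ≤ β) (hβ : β < 1) (hk : 0 < k)
    (h : ∀ v : ℂ, 0 ≤ v.re → ‖f v‖ ≤ Real.exp (β * ((v.re + 1) * Real.log (v.re + 1)) +
      C * (v.re + 1) - k * |v.im|)) : f ∈ M2omega := by
  have hline : ∀ x : ℝ, 0 ≤ x → ∀ y : ℝ, ‖f ((x : ℂ) + (y : ℂ) * Complex.I)‖ ≤
      Real.exp (β * ((x + 1) * Real.log (x + 1)) + C * (x + 1) - k * |y|) := by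
    intro x hx y
    have := h ((x : ℂ) + (y : ℂ) * Complex.I) (by simpa using hx)
    simpa using this
  have hI := lintegral_exp_neg_abs_lt_top (k := 2 * k) (by positivity)
  set I := ∫⁻ y : ℝ, ENNReal.ofReal (Real.exp (-(2 * k * |y|))) with hIdef
  refine ⟨hf.differentiableOn.mono rightHalfPlane_subset, fun b hb => ⟨?_, ?_⟩, ?_⟩
  · exact hf.differentiableOn.mono fun v hv => rightHalfPlane_subset hv.1
  · refine lt_of_le_of_lt (iSup₂_le fun x hx => ?_) (ENNReal.mul_lt_top
      (ENNReal.ofReal_lt_top (r := Real.exp (2 * (β * ((b + 1) * Real.log (b + 1)) +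
        |C| * (b + 1))))) hI)
    refine lintegral_line_le_of_norm_le fun y => (hline x hx.1.le y).trans ?_
    have h1 : 0 ≤ Real.log (x + 1) := Real.log_nonneg (by linarith [hx.1])
    have h2 : Real.log (x + 1) ≤ Real.log (b + 1) :=
      Real.log_le_log (by linarith [hx.1]) (by linarith [hx.2])
    have h3 := hx.1
    have h4 := hx.2.le
    have h5 := le_abs_self C
    gcongr
  · refine ⟨(measurable_boundaryExtension hf.continuousOn).aestronglyMeasurable, ?_⟩
    rw [eLpNorm_lt_top_iff_lintegral_rpow_enorm_lt_top (by simp) (by simp)]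
    have hmeas := (measurable_boundaryExtension hf.continuousOn).enorm.pow_const 2
    simp only [ENNReal.toReal_ofNat, ENNReal.rpow_ofNat]
    rw [lintegral_omegaMeasure hmeas]
    have hle : ∀ n : ℕ, ENNReal.ofReal (2 ^ n / (n.factorial : ℝ)) *
        ∫⁻ y : ℝ, ‖boundaryExtension f ((n : ℂ) / 2 + (y : ℂ) * Complex.I)‖ₑ ^ 2 ≤
        ENNReal.ofReal (2 ^ n / (n.factorial : ℝ) *
          Real.exp (2 * (β * (((n : ℝ) / 2 + 1) * Real.log ((n : ℝ) / 2 + 1)) +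
            C * ((n : ℝ) / 2 + 1)))) * I := by
      intro n
      rw [ENNReal.ofReal_mul (by positivity), mul_assoc]
      gcongr
      have e : (n : ℂ) / 2 = (((n : ℝ) / 2 : ℝ) : ℂ) := by push_cast; rfl
      simp_rw [e]
      refine le_trans (le_of_eq (lintegral_congr fun y => ?_))
        (lintegral_line_le_of_norm_le fun y => hline ((n : ℝ) / 2) (by positivity) y)
      rw [boundaryExtension_eq_of_mem hf.continuousOn]
      simp only [closedRightHalfPlane, mem_ofPred_eq]
      simp
      positivity
    refine lt_of_le_of_lt (ENNReal.tsum_le_tsum hle) ?_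
    rw [ENNReal.tsum_mul_right]
    exact ENNReal.mul_lt_top (summable_omega_weights hβ0 hβ).tsum_ofReal_lt_top hI

/-! ### The damping factor and the sufficient condition. -/

/-- A zero-free function decaying exponentially in vertical directions. -/
noncomputable def damping (b : ℝ) (v : ℂ) : ℂ :=
  Complex.exp ((b : ℂ) * ((v + 1) * Complex.log (v + 1)))

theorem analyticAt_damping (b : ℝ) {v : ℂ} (hv : 0 ≤ v.re) : AnalyticAt ℂ (damping b) v := by
  have h : AnalyticAt ℂ (fun w : ℂ => Complex.log (w + 1)) v := by
    refine AnalyticAt.clog (by fun_prop) (Or.inl ?_)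
    simp only [Complex.add_re, Complex.one_re]
    linarith
  unfold damping
  fun_prop

theorem norm_damping (b : ℝ) (v : ℂ) : ‖damping b v‖ =
    Real.exp (b * ((v.re + 1) * Real.log ‖v + 1‖ - v.im * (v + 1).arg)) := by
  rw [damping, Complex.norm_exp, Complex.re_ofReal_mul, Complex.mul_re, Complex.log_re,
    Complex.log_im]
  simp

theorem isZeroSet_of_count {z : ℕ → ℂ} (hz : ∀ j, 0 < (z j).re)
    (hz1 : ∀ j, 1 ≤ ‖z j‖) (hsum : Summable fun j => 1 / ‖z j‖ ^ 2)
    (hfin : ∀ R : ℝ, {j | ‖z j‖ ≤ R}.Finite) {c r₀ : ℝ} (hc0 : 0 < c) (hc1 : c < 1 / 2)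
    (hr₀ : 1 ≤ r₀) (hcount : ∀ r, r₀ ≤ r → (countingFunction z r : ℝ) ≤ c * r) :
    IsZeroSet closedRightHalfPlane (M2omega ∩ HolClosed) z := by
  -- Half of the room left below `1`, so that `2 c + b < 1`.
  set b := (1 - 2 * c) / 2 with hb
  have hb0 : 0 < b := by rw [hb]; linarith
  have hb1 : b ≤ 1 := by rw [hb]; linarith
  set f : ℂ → ℂ := canonicalProduct z * damping b with hf
  have hana := fun (w : ℂ) (hw : 0 ≤ w.re) => canonicalProduct_analytic hz hz1 hsum hfin hw
  have hfa : AnalyticOnNhd ℂ f closedRightHalfPlane := fun w hw =>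
    (hana w hw).1.mul (analyticAt_damping b hw)
  refine ⟨f, ⟨mem_M2omega_of_norm_le hfa (β := 2 * c + b) (k := b / 2)
    (C := 2 * (c * Real.log (2 + r₀) + (r₀ + 21)) + b + (2 * c + b) * Real.log (1 / (b / 2)))
    (by positivity) (by linarith) (by positivity) ?_, hfa⟩, ?_⟩
  · intro v hv
    set X := v.re + 1 with hX
    have hX1 : 1 ≤ X := by linarith
    set t := ‖v + 1‖ with ht
    have hre : (v + 1).re = X := by simp [hX]
    have him : (v + 1).im = v.im := by simp
    have hXt : X ≤ t := by rw [← hre]; exact Complex.re_le_norm _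
    have hvt : ‖v‖ ≤ t := by
      refine le_of_sq_le_sq ?_ (norm_nonneg _)
      rw [Complex.sq_norm, Complex.sq_norm, Complex.normSq_apply, Complex.normSq_apply, hre, him]
      nlinarith
    have htX : t ≤ X + |v.im| := by
      have := Complex.norm_le_abs_re_add_abs_im (v + 1)
      rwa [hre, him, abs_of_pos (by linarith)] at this
    have ht1 : 1 ≤ t := hX1.trans hXt
    have hlt : 0 ≤ Real.log t := Real.log_nonneg ht1
    have hlr : 0 ≤ Real.log (2 + r₀) := Real.log_nonneg (by linarith)
    have hρ : Real.log (2 * ‖v‖ + r₀) ≤ Real.log t + Real.log (2 + r₀) := by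
      rw [← Real.log_mul (by linarith) (by linarith)]
      refine Real.log_le_log (by linarith [norm_nonneg v]) ?_
      nlinarith
    have harg : |v.im| - X ≤ v.im * (v + 1).arg := by
      have := abs_im_sub_re_le (w := v + 1) (by rw [hre]; linarith)
      rwa [hre, him] at this
    -- Trading `log t` for `log X` spends at most half of the decay `b |Im v|` supplied by
    -- `damping`.
    have hlog : X * Real.log t ≤ X * Real.log X + b / 2 * |v.im| + X * Real.log (1 / (b / 2)) := by
      refine le_trans ?_ (mul_log_le (by linarith) (abs_nonneg _) (by positivity) (by linarith))
      gcongr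
    have hP := norm_canonicalProduct_le_exp hz hz1 hsum hfin hc0 (by linarith) hr₀ hcount hv
    rw [hf, Pi.mul_apply, norm_mul, norm_damping]
    refine (mul_le_mul_of_nonneg_right hP (Real.exp_nonneg _)).trans ?_
    rw [← Real.exp_add]
    refine Real.exp_le_exp.2 ?_
    have e1 : 2 * v.re * (c * Real.log (2 * ‖v‖ + r₀) + (r₀ + 21)) ≤
        2 * X * (c * (Real.log t + Real.log (2 + r₀)) + (r₀ + 21)) := by
      calc _ ≤ 2 * v.re * (c * (Real.log t + Real.log (2 + r₀)) + (r₀ + 21)) := by gcongr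
        _ ≤ _ := by gcongr; linarith
    have e2 : (2 * c + b) * (X * Real.log t) ≤
        (2 * c + b) * (X * Real.log X + b / 2 * |v.im| + X * Real.log (1 / (b / 2))) := by gcongr
    have e3 : b * (|v.im| - X) ≤ b * (v.im * (v + 1).arg) := by gcongr
    have e4 : (2 * c + b) * (b / 2 * |v.im|) ≤ b / 2 * |v.im| := by
      refine mul_le_of_le_one_left (by positivity) (by rw [hb]; linarith)
    linarith
  · intro w hw
    have hd0 : analyticOrderAt (damping b) w = 0 :=
      (analyticAt_damping b hw).analyticOrderAt_eq_zero.2 (Complex.exp_ne_zero _)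
    rw [hf, analyticOrderAt_mul (hana w hw).1 (analyticAt_damping b hw), (hana w hw).2, hd0,
      add_zero]

theorem isZeroSet_of_upperDensity_lt {z : ℕ → ℂ} (hz : ∀ j, z j ∈ rightHalfPlane)
    (hz1 : ∀ j, 1 ≤ ‖z j‖) (hzlim : Tendsto (fun j => ‖z j‖) atTop atTop)
    (hexp : convergenceExponent z = 1) (hden : upperDensity z < ((1 / 2 : ℝ) : EReal)) :
    IsZeroSet closedRightHalfPlane (M2omega ∩ HolClosed) z := by
  have hfin : ∀ R : ℝ, {j | ‖z j‖ ≤ R}.Finite := by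
    intro R
    have := hzlim.eventually_gt_atTop R
    rw [← Nat.cofinite_eq_atTop] at this
    simpa using this
  have hsum : Summable fun j => 1 / ‖z j‖ ^ 2 := by
    have h1 : convergenceExponent z < ((2 : ℝ) : EReal) := by
      rw [hexp]; exact_mod_cast (by norm_num : (1 : ℝ) < 2)
    simp only [convergenceExponent, iInf_lt_iff] at h1
    obtain ⟨ρ, -, hs, hρ⟩ := h1
    have hρ2 : ρ < 2 := by exact_mod_cast hρ
    refine Summable.of_nonneg_of_le (fun j => by positivity) (fun j => ?_) hs
    have := hz1 j
    rw [← Real.rpow_natCast]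
    gcongr
    exact_mod_cast hρ2.le
  obtain ⟨c', hc', hc2⟩ := EReal.lt_iff_exists_real_btwn.1 hden
  have hc2' : c' < 1 / 2 := by exact_mod_cast hc2
  have hev := eventually_lt_of_limsup_lt hc'
  rw [hexp] at hev
  obtain ⟨r₁, hr₁⟩ := eventually_atTop.1 hev
  -- The maximum with `1 / 4` makes positivity of `c` immediate and keeps it below `1 / 2`.
  refine isZeroSet_of_count hz hz1 hsum hfin (c := max c' (1 / 4)) (r₀ := max r₁ 1)
    (lt_max_of_lt_right (by norm_num)) (max_lt hc2' (by norm_num)) (le_max_right _ _) ?_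
  intro r hr
  have h1 := hr₁ r ((le_max_left _ _).trans hr)
  have hr1 : 0 < r := zero_lt_one.trans_le ((le_max_right _ _).trans hr)
  rw [EReal.coe_lt_coe_iff, EReal.toReal_one, Real.rpow_one, div_lt_iff₀ hr1] at h1
  refine h1.le.trans ?_
  gcongr
  exact le_max_left _ _

end HalfPlane

theorem mainTheorem6 (z : ℕ → ℂ) (hz : ∀ j, z j ∈ HalfPlane.rightHalfPlane)
    (hz1 : ∀ j, 1 ≤ ‖z j‖) (hzlim : Tendsto (fun j => ‖z j‖) atTop atTop) :
    (HalfPlane.convergenceExponent z = 1 →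
      HalfPlane.upperDensity z < ((1 / 2 : ℝ) : EReal) →
      HalfPlane.IsZeroSet HalfPlane.closedRightHalfPlane
        (HalfPlane.M2omega ∩ HalfPlane.HolClosed) z) ∧
    (HalfPlane.IsZeroSet HalfPlane.rightHalfPlane
        (HalfPlane.M2omega ∩ HalfPlane.HolClosed) z →
      limsup (fun R : ℝ =>
          ((1 / Real.log R * ∑ᶠ (j : ℕ) (_ : ‖z j‖ ≤ R), (1 / z j).re : ℝ) : EReal)) atTop
        ≤ ((2 / Real.pi : ℝ) : EReal)) :=
  ⟨HalfPlane.isZeroSet_of_upperDensity_lt hz hz1 hzlim, HalfPlane.limsup_sum_le hz hz1 hzlim⟩
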